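/- Throughout, $L^2$ is a smooth two-dimensional manifold (Hausdorff, second countable, without boundary), a surface $f\colon L^2\to\mathbb{R}^{n+1}$ is a smooth immersion, $\langle\,,\,\rangle_f$, $\nabla^f$ and $\alpha_f$ denote its induced metric, the Levi-Civita connection of that metric and its second fundamental form, and $\mathfrak{X}(L)$ is the set of smooth vector fields on $L^2$. The surface $f$ has flat normal bundle if the curvature of its normal connection vanishes. A surface $g\colon L^2\to\mathbb{S}^n\subset\mathbb{R}^{n+1}$, with second fundamental form $\alpha_g$ in $\mathbb{S}^n$, is of type $D$ if there exist pointwise linearly independent $X,Y\in\mathfrak{X}(L)$ with $\langle Y,Y\rangle_g=1$ such that everywhere on $L^2$ $$\text{(i) } \langle X,Y\rangle_g\neq 0,\qquad \text{(ii) } \nabla^g_XY=0,\qquad \text{(iii) } \alpha_g(X,Y)=0.$$ Given a surface $h\colon L^2\to\mathbb{R}^{n+1}$ and $X,Y\in\mathfrak{X}(L)$, consider the following condition. $(\ast)$ $h$ has flat normal bundle; $X,Y$ is an orthonormal frame for $\langle\,,\,\rangle_h$ that diagonalizes the second fundamental form, that is, $\alpha_h(X,Y)=0$; the integral curves of $X$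 and of $Y$ are nowhere geodesics, that is, at every point of $L^2$, $\nabla^h_XX\notin\mathrm{span}\{X\}$ and $\nabla^h_YY\notin\mathrm{span}\{Y\}$; and the integral curves of $X$ are nowhere asymptotic, that is, $\alpha_h(X,X)\neq0$ at every point of $L^2$. **Theorem.** Let $n\geq 3$. 1. If $h\colon L^2\to\mathbb{R}^{n+1}$ is a surface and $X,Y\in\mathfrak{X}(L)$ satisfy $(\ast)$, then $g=h_*X$ takes values in $\mathbb{S}^n$ and is a surface of type $D$. 2. Conversely, every surface of type $D$ arises locally in this way: if $g\colon L^2\to\mathbb{S}^n$ is a surface of type $D$, then every point of $L^2$ has an open neighborhood $U$ on which there exist a surface $h\colon U\to\mathbb{R}^{n+1}$ and $X,Y\in\mathfrak{X}(U)$ that satisfy $(\ast)$ on $U$ and $g|_U=h_*X$. -/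

import Mathlib

open Set VectorField
open scoped Manifold ContDiff InnerProductSpace

namespace SurfaceGeometry

section Definitions

variable {L : Type*} [TopologicalSpace L] [ChartedSpace (EuclideanSpace ℝ (Fin 2)) L]
  {V : Type*} [NormedAddCommGroup V] [InnerProductSpace ℝ V]

/-- The derivative `X φ` of a vector-valued map `φ` on `L` along a vector field `X`.
For an immersion `f : L → V` into a Euclidean space it is the push-forward `f_* X`,
and for an arbitrary `V`-valued map along `f` it is its derivative along `X` with respect to the
standard connection of the Euclidean space `V`. -/
noncomputable def along (X : (p : L) → TangentSpace (𝓡 2) p) (φ : L → V) : L → V :=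
  fun p => mvfderiv (𝓡 2) φ p (X p)

/-- Smoothness of a vector field on `L`. -/
def IsSmoothField [IsManifold (𝓡 2) ∞ L] (X : (p : L) → TangentSpace (𝓡 2) p) : Prop :=
  ContMDiff (𝓡 2) (𝓡 2).tangent ∞ (fun p => (⟨p, X p⟩ : TangentBundle (𝓡 2) L))

/-- `f : L → V` is a (parametrized) surface: a smooth immersion. -/
structure IsSurface (f : L → V) : Prop where
  smooth : ContMDiff (𝓡 2) 𝓘(ℝ, V) ∞ f
  injective : ∀ p : L, Function.Injective (mvfderiv (𝓡 2) f p)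

/-- The metric on `L` induced by `f`, evaluated on two vector fields. -/
noncomputable def inducedMetric (f : L → V) (X Y : (p : L) → TangentSpace (𝓡 2) p) : L → ℝ :=
  fun p => ⟪along X f p, along Y f p⟫_ℝ

/-- The tangent plane `f_* T_p L`, as a linear subspace of `V`. -/
noncomputable def tangentPlane (f : L → V) (p : L) : Submodule ℝ V :=
  LinearMap.range (mvfderiv (𝓡 2) f p).toLinearMap

instance (f : L → V) (p : L) : FiniteDimensional ℝ (tangentPlane f p) := by
  unfold tangentPlane
  have : FiniteDimensional ℝ (TangentSpace (𝓡 2) p) :=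
    inferInstanceAs (FiniteDimensional ℝ (EuclideanSpace ℝ (Fin 2)))
  infer_instance

theorem exists_tangentialPart (f : L → V) (p : L) (v : V) :
    ∃ w : TangentSpace (𝓡 2) p, mvfderiv (𝓡 2) f p w = (tangentPlane f p).starProjection v :=
  (tangentPlane f p).starProjection_apply_mem v

/-- The tangential component of `v ∈ V` at `p`, as a vector of `T_p L`. -/
noncomputable def tangentialPart (f : L → V) (p : L) (v : V) : TangentSpace (𝓡 2) p :=
  (exists_tangentialPart f p v).choose

/-- The Levi-Civita connection `∇_X Y` of the metric induced by the surface `f`: the tangential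
component of the derivative of `f_* Y` along `X`. That this is the torsion-free metric connection,
hence given by the Koszul formula in terms of the induced metric only, is
`leviCivita_metric`, `leviCivita_torsion`, `leviCivita_koszul` below. -/
noncomputable def leviCivita (f : L → V) (X Y : (p : L) → TangentSpace (𝓡 2) p) :
    (p : L) → TangentSpace (𝓡 2) p :=
  fun p => tangentialPart f p (along X (along Y f) p)

/-- The component of `v ∈ V` in the normal space `N_f L(p)` of `f : L → V`. -/
noncomputable def normalPart (f : L → V) (p : L) (v : V) : V :=
  (tangentPlane f p)ᗮ.starProjection v

/-- The second fundamental form `α_f(X, Y)` of a surface `f : L → V` in the Euclidean space `V`. -/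
noncomputable def secondForm (f : L → V) (X Y : (p : L) → TangentSpace (𝓡 2) p) : L → V :=
  fun p => normalPart f p (along X (along Y f) p)

/-- The normal connection `∇^⊥_X ξ` of a surface `f : L → V`. -/
noncomputable def normalConnection (f : L → V) (X : (p : L) → TangentSpace (𝓡 2) p) (ξ : L → V) :
    L → V :=
  fun p => normalPart f p (along X ξ p)

/-- The curvature `R^⊥(X, Y) ξ` of the normal connection. -/
noncomputable def normalCurvature (f : L → V) (X Y : (p : L) → TangentSpace (𝓡 2) p)
    (ξ : L → V) : L → V :=
  fun p => normalConnection f X (normalConnection f Y ξ) p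
    - normalConnection f Y (normalConnection f X ξ) p
    - normalConnection f (mlieBracket (𝓡 2) X Y) ξ p

/-- `ξ` is a smooth section of the normal bundle of `f`. -/
structure IsNormalField (f : L → V) (ξ : L → V) : Prop where
  smooth : ContMDiff (𝓡 2) 𝓘(ℝ, V) ∞ ξ
  normal : ∀ p : L, ξ p ∈ (tangentPlane f p)ᗮ

/-- The normal bundle of `f` is flat: the curvature of the normal connection vanishes. -/
def HasFlatNormalBundle [IsManifold (𝓡 2) ∞ L] (f : L → V) : Prop :=
  ∀ (X Y : (p : L) → TangentSpace (𝓡 2) p) (ξ : L → V), IsSmoothField X → IsSmoothField Y →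
    IsNormalField f ξ → ∀ p : L, normalCurvature f X Y ξ p = 0

/-- `X, Y` is a smooth frame that is orthonormal for the metric induced by `f`. -/
structure IsOrthonormalFrame [IsManifold (𝓡 2) ∞ L] (f : L → V)
    (X Y : (p : L) → TangentSpace (𝓡 2) p) : Prop where
  smooth_fst : IsSmoothField X
  smooth_snd : IsSmoothField Y
  unit_fst : ∀ p : L, inducedMetric f X X p = 1
  unit_snd : ∀ p : L, inducedMetric f Y Y p = 1
  orthogonal : ∀ p : L, inducedMetric f X Y p = 0

/-- The integral curves of `X` are nowhere geodesics for the metric induced by `f`: at no point is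
`∇_X X` tangent to the curve. -/
def NowhereGeodesic (f : L → V) (X : (p : L) → TangentSpace (𝓡 2) p) : Prop :=
  ∀ p : L, leviCivita f X X p ∉ Submodule.span ℝ {X p}

/-- The integral curves of `X` are nowhere asymptotic for `f`. -/
def NowhereAsymptotic (f : L → V) (X : (p : L) → TangentSpace (𝓡 2) p) : Prop :=
  ∀ p : L, secondForm f X X p ≠ 0

/-- `h` is a surface with flat normal bundle in `V` and `X, Y` is an orthonormal frame that
diagonalizes its second fundamental form, the integral curves of `X` and `Y` are nowhere geodesics
and the integral curves of `X` are nowhere asymptotic. -/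
structure IsGenericPrincipalFrame [IsManifold (𝓡 2) ∞ L] (h : L → V)
    (X Y : (p : L) → TangentSpace (𝓡 2) p) : Prop where
  surface : IsSurface h
  flat : HasFlatNormalBundle h
  frame : IsOrthonormalFrame h X Y
  diagonal : ∀ p : L, secondForm h X Y p = 0
  geodesic_fst : NowhereGeodesic h X
  geodesic_snd : NowhereGeodesic h Y
  asymptotic_fst : NowhereAsymptotic h X

/-- The second fundamental form `α_g(X, Y)` of a surface `g` in the unit sphere of `V`: the
component of the derivative of `g_* Y` along `X` that is orthogonal to the tangent plane of `g`
within the tangent space `(ℝ g(p))ᗮ` of the sphere at `g(p)`. -/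
noncomputable def sphereSecondForm [FiniteDimensional ℝ V] (g : L → V)
    (X Y : (p : L) → TangentSpace (𝓡 2) p) : L → V :=
  fun p => ((ℝ ∙ g p)ᗮ ⊓ (tangentPlane g p)ᗮ).starProjection (along X (along Y g) p)

/-- `g` is a surface of type `D` in the unit sphere of `V`. -/
structure IsTypeD [FiniteDimensional ℝ V] [IsManifold (𝓡 2) ∞ L] (g : L → V) : Prop where
  surface : IsSurface g
  mem_sphere : ∀ p : L, ‖g p‖ = 1
  exists_fields : ∃ X Y : (p : L) → TangentSpace (𝓡 2) p,
    IsSmoothField X ∧ IsSmoothField Y ∧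
    (∀ p : L, LinearIndependent ℝ ![X p, Y p]) ∧
    (∀ p : L, inducedMetric g Y Y p = 1) ∧
    (∀ p : L, inducedMetric g X Y p ≠ 0) ∧
    (∀ p : L, leviCivita g X Y p = 0) ∧
    (∀ p : L, sphereSecondForm g X Y p = 0)

theorem inner_tangentialPart (f : L → V) (p : L) (v : V) (w : TangentSpace (𝓡 2) p) :
    ⟪mvfderiv (𝓡 2) f p (tangentialPart f p v), mvfderiv (𝓡 2) f p w⟫_ℝ
      = ⟪v, mvfderiv (𝓡 2) f p w⟫_ℝ := by
  rw [tangentialPart, (exists_tangentialPart f p v).choose_spec]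
  have hw : mvfderiv (𝓡 2) f p w ∈ tangentPlane f p := ⟨w, rfl⟩
  rw [Submodule.inner_starProjection_left_eq_right,
    Submodule.starProjection_eq_self_iff.mpr hw]

end Definitions

section LeviCivita

variable {L : Type*} [TopologicalSpace L] [ChartedSpace (EuclideanSpace ℝ (Fin 2)) L]
  [IsManifold (𝓡 2) ∞ L]
  {V : Type*} [NormedAddCommGroup V] [InnerProductSpace ℝ V]

/-- `f_* X` in a chart. -/
theorem along_extChartAt_symm {f : L → V} (p : L) {q : EuclideanSpace ℝ (Fin 2)}
    (hq : q ∈ (extChartAt (𝓡 2) p).target)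
    (hf : MDifferentiableAt (𝓡 2) 𝓘(ℝ, V) f ((extChartAt (𝓡 2) p).symm q))
    (X : (p : L) → TangentSpace (𝓡 2) p) :
    along X f ((extChartAt (𝓡 2) p).symm q) =
      fderiv ℝ (f ∘ (extChartAt (𝓡 2) p).symm) q
        (mpullbackWithin 𝓘(ℝ, EuclideanSpace ℝ (Fin 2)) (𝓡 2) (extChartAt (𝓡 2) p).symm X
          (range (𝓡 2)) q) := by
  have : IsManifold (𝓡 2) 1 L := IsManifold.of_le (n := ∞) (by simp)
  have h1 := mdifferentiableWithinAt_extChartAt_symm (I := 𝓡 2) hq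
  have h2 := isInvertible_mfderivWithin_extChartAt_symm (I := 𝓡 2) hq
  have h3 := mfderiv_comp_mfderivWithin q hf h1 ((𝓡 2).uniqueMDiffOn q (by simp))
  have h4 : mfderivWithin 𝓘(ℝ, EuclideanSpace ℝ (Fin 2)) 𝓘(ℝ, V)
      (f ∘ (extChartAt (𝓡 2) p).symm) (range (𝓡 2)) q
      = fderiv ℝ (f ∘ (extChartAt (𝓡 2) p).symm) q := by
    rw [mfderivWithin_eq_fderivWithin, (𝓡 2).range_eq_univ, fderivWithin_univ]
  rw [← h4, h3, mpullbackWithin_apply]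
  exact congrArg (mvfderiv (𝓡 2) f ((extChartAt (𝓡 2) p).symm q))
    (h2.self_apply_inverse _).symm

theorem along_eq_fderiv {f : L → V} {p : L} (hf : MDifferentiableAt (𝓡 2) 𝓘(ℝ, V) f p)
    (X : (p : L) → TangentSpace (𝓡 2) p) :
    along X f p = fderiv ℝ (f ∘ (extChartAt (𝓡 2) p).symm) (extChartAt (𝓡 2) p p)
      (mpullbackWithin 𝓘(ℝ, EuclideanSpace ℝ (Fin 2)) (𝓡 2) (extChartAt (𝓡 2) p).symm X
        (range (𝓡 2)) (extChartAt (𝓡 2) p p)) := by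
  have hp : (extChartAt (𝓡 2) p).symm (extChartAt (𝓡 2) p p) = p := extChartAt_to_inv p
  have h := along_extChartAt_symm (f := f) p (mem_extChartAt_target p) (by rwa [hp]) X
  rwa [hp] at h

theorem contDiffAt_comp_extChartAt_symm {f : L → V} {p : L}
    (hf : ContMDiff (𝓡 2) 𝓘(ℝ, V) ∞ f) :
    ContDiffAt ℝ ∞ (f ∘ (extChartAt (𝓡 2) p).symm) (extChartAt (𝓡 2) p p) := by
  have h := (hf.contMDiffOn (s := univ)).comp (contMDiffOn_extChartAt_symm (n := ∞) (I := 𝓡 2) p)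
    (fun _ _ => mem_univ _)
  exact (contMDiffOn_iff_contDiffOn.mp h).contDiffAt (extChartAt_target_mem_nhds p)

theorem contMDiff_along {f : L → V} (hf : ContMDiff (𝓡 2) 𝓘(ℝ, V) ∞ f)
    {X : (p : L) → TangentSpace (𝓡 2) p} (hX : IsSmoothField X) :
    ContMDiff (𝓡 2) 𝓘(ℝ, V) ∞ (along X f) :=
  (contMDiff_snd_tangentBundle_modelSpace V 𝓘(ℝ, V)).comp
    ((hf.contMDiff_tangentMap (m := ∞) (by simp)).comp hX)

/-- `[X, Y] f = X (Y f) - Y (X f)`. -/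
theorem along_mlieBracket {f : L → V} (hf : ContMDiff (𝓡 2) 𝓘(ℝ, V) ∞ f)
    {X Y : (p : L) → TangentSpace (𝓡 2) p} (hX : IsSmoothField X) (hY : IsSmoothField Y) (p : L) :
    along (mlieBracket (𝓡 2) X Y) f p = along X (along Y f) p - along Y (along X f) p := by
  have : IsManifold (𝓡 2) 1 L := IsManifold.of_le (n := ∞) (by simp)
  set e := extChartAt (𝓡 2) p with he
  set F := f ∘ e.symm with hF
  set q₀ := e p with hq₀
  have hp : e.symm q₀ = p := extChartAt_to_inv p
  have hq₀t : q₀ ∈ e.target := mem_extChartAt_target p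
  let P (Z : (p : L) → TangentSpace (𝓡 2) p) :
      EuclideanSpace ℝ (Fin 2) → EuclideanSpace ℝ (Fin 2) :=
    mpullbackWithin 𝓘(ℝ, EuclideanSpace ℝ (Fin 2)) (𝓡 2) e.symm Z (range (𝓡 2))
  have hnear : ∀ᶠ q in nhds q₀, q ∈ e.target := extChartAt_target_mem_nhds p
  have hFs : ContDiffAt ℝ ∞ F q₀ := contDiffAt_comp_extChartAt_symm hf
  have hP : ∀ Z, IsSmoothField Z → DifferentiableAt ℝ (P Z) q₀ := by
    intro Z hZ
    have h := contMDiffWithinAt_mpullbackWithin_extChartAt_symm (n := ∞) (m := ∞) (x := p)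
      (s := univ) (hZ p).contMDiffWithinAt uniqueMDiffOn_univ (mem_univ _) (by simp)
    rw [preimage_univ, inter_univ] at h
    have h' := (contMDiffWithinAt_vectorSpace_iff_contDiffWithinAt.mp h).contDiffAt hnear
    exact h'.differentiableAt (by simp)
  have hloc : ∀ (φ : L → V), ContMDiff (𝓡 2) 𝓘(ℝ, V) ∞ φ → ∀ Z, along Z φ p
      = fderiv ℝ (φ ∘ e.symm) q₀ (P Z q₀) := by
    exact fun φ hφ Z => along_eq_fderiv ((hφ _).mdifferentiableAt (by simp)) Z
  have hcomp : ∀ Z, (along Z f) ∘ e.symm =ᶠ[nhds q₀] fun q => fderiv ℝ F q (P Z q) := by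
    intro Z
    filter_upwards [hnear] with q hq
    exact along_extChartAt_symm (f := f) p hq ((hf _).mdifferentiableAt (by simp)) Z
  have hdF : DifferentiableAt ℝ (fderiv ℝ F) q₀ :=
    (hFs.fderiv_right (m := ∞) (by simp)).differentiableAt (by simp)
  have hsecond : ∀ Z W, IsSmoothField Z → along W (along Z f) p
      = fderiv ℝ (fderiv ℝ F) q₀ (P W q₀) (P Z q₀) + fderiv ℝ F q₀ (fderiv ℝ (P Z) q₀ (P W q₀)) := by
    intro Z W hZ
    rw [hloc _ (contMDiff_along hf hZ) W, (hcomp Z).fderiv_eq, fderiv_clm_apply hdF (hP Z hZ)]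
    simp [add_comm]
  have hsymm : fderiv ℝ (fderiv ℝ F) q₀ (P X q₀) (P Y q₀)
      = fderiv ℝ (fderiv ℝ F) q₀ (P Y q₀) (P X q₀) :=
    (hFs.isSymmSndFDerivAt (by simp only [minSmoothness_of_isRCLikeNormedField]; exact ENat.LEInfty.out)).eq _ _
  have hbr : along (mlieBracket (𝓡 2) X Y) f p = fderiv ℝ F q₀ (lieBracket ℝ (P X) (P Y) q₀) := by
    have hinv := isInvertible_mfderiv_extChartAt (I := 𝓡 2) (mem_extChartAt_source (I := 𝓡 2) p)
    have h1 : mfderiv (𝓡 2) 𝓘(ℝ, EuclideanSpace ℝ (Fin 2)) e p (mlieBracket (𝓡 2) X Y p)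
        = lieBracket ℝ (P X) (P Y) q₀ := by
      have hs : e.symm ⁻¹' univ ∩ range (𝓡 2) = univ := by
        rw [(𝓡 2).range_eq_univ, preimage_univ, univ_inter]
      have hb : lieBracketWithin ℝ (P X) (P Y) (e.symm ⁻¹' univ ∩ range (𝓡 2)) q₀
          = lieBracket ℝ (P X) (P Y) q₀ := by
        rw [hs, lieBracketWithin_univ]
      exact (hinv.self_apply_inverse _).trans hb
    have h2 : f =ᶠ[nhds p] F ∘ e := by
      filter_upwards [extChartAt_source_mem_nhds (I := 𝓡 2) p] with x hx
      exact congrArg f ((extChartAt (𝓡 2) p).left_inv hx).symm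
    have h3 : mfderiv (𝓡 2) 𝓘(ℝ, V) (F ∘ e) p
        = (mfderiv 𝓘(ℝ, EuclideanSpace ℝ (Fin 2)) 𝓘(ℝ, V) F q₀).comp
          (mfderiv (𝓡 2) 𝓘(ℝ, EuclideanSpace ℝ (Fin 2)) e p) := mfderiv_comp p (hFs.differentiableAt (by simp)).mdifferentiableAt
      (mdifferentiableAt_extChartAt (I := 𝓡 2) (mem_chart_source (EuclideanSpace ℝ (Fin 2)) p))
    rw [← h2.mfderiv_eq, mfderiv_eq_fderiv] at h3
    rw [← h1]
    exact DFunLike.congr_fun h3 _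
  rw [hbr, hsecond Y X hY, hsecond X Y hX, hsymm, lieBracket, map_sub]
  abel

/-- `leviCivita` is compatible with the induced metric. -/
theorem leviCivita_metric {f : L → V} (hf : IsSurface f) {Y Z : (p : L) → TangentSpace (𝓡 2) p}
    (X : (p : L) → TangentSpace (𝓡 2) p) (hY : IsSmoothField Y) (hZ : IsSmoothField Z) (p : L) :
    along X (inducedMetric f Y Z) p =
      inducedMetric f (leviCivita f X Y) Z p + inducedMetric f Y (leviCivita f X Z) p := by
  have h1 : inducedMetric f (leviCivita f X Y) Z p = ⟪along X (along Y f) p, along Z f p⟫_ℝ :=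
    inner_tangentialPart f p _ _
  have h2 : inducedMetric f Y (leviCivita f X Z) p = ⟪along Y f p, along X (along Z f) p⟫_ℝ := by
    rw [real_inner_comm]
    exact (real_inner_comm _ _).trans (inner_tangentialPart f p _ _)
  rw [h1, h2]
  have hYs : MDifferentiableAt (𝓡 2) 𝓘(ℝ, V) (along Y f) p :=
    (contMDiff_along hf.smooth hY p).mdifferentiableAt (by simp)
  have hZs : MDifferentiableAt (𝓡 2) 𝓘(ℝ, V) (along Z f) p :=
    (contMDiff_along hf.smooth hZ p).mdifferentiableAt (by simp)
  have hI : ContMDiff (𝓡 2) 𝓘(ℝ, ℝ) ∞ (inducedMetric f Y Z) :=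
    contDiff_inner.comp_contMDiff
      ((contMDiff_along hf.smooth hY).prodMk_space (contMDiff_along hf.smooth hZ))
  have hp : (extChartAt (𝓡 2) p).symm (extChartAt (𝓡 2) p p) = p := extChartAt_to_inv p
  rw [along_eq_fderiv ((hI p).mdifferentiableAt (by simp)), along_eq_fderiv hYs X,
    along_eq_fderiv hZs X]
  have h := fderiv_inner_apply ℝ
    ((contDiffAt_comp_extChartAt_symm (p := p)
      (contMDiff_along hf.smooth hY)).differentiableAt (by simp))
    ((contDiffAt_comp_extChartAt_symm (p := p)
      (contMDiff_along hf.smooth hZ)).differentiableAt (by simp))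
    (mpullbackWithin 𝓘(ℝ, EuclideanSpace ℝ (Fin 2)) (𝓡 2) (extChartAt (𝓡 2) p).symm X
        (range (𝓡 2)) (extChartAt (𝓡 2) p p))
  simp only [Function.comp_apply, hp] at h
  exact h.trans (add_comm _ _)

/-- `leviCivita` is torsion-free. -/
theorem leviCivita_torsion {f : L → V} (hf : IsSurface f) {X Y : (p : L) → TangentSpace (𝓡 2) p}
    (hX : IsSmoothField X) (hY : IsSmoothField Y) (p : L) :
    leviCivita f X Y p - leviCivita f Y X p = mlieBracket (𝓡 2) X Y p := by
  apply hf.injective p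
  rw [map_sub]
  have h := along_mlieBracket hf.smooth hX hY p
  have hm : mvfderiv (𝓡 2) f p (mlieBracket (𝓡 2) X Y p) ∈ tangentPlane f p := ⟨_, rfl⟩
  rw [leviCivita, leviCivita, tangentialPart, tangentialPart,
    (exists_tangentialPart f p _).choose_spec, (exists_tangentialPart f p _).choose_spec,
    ← map_sub, ← h]
  exact Submodule.starProjection_eq_self_iff.mpr hm

/-- The Koszul formula, which determines `∇_X Y` from the induced metric alone. -/
theorem leviCivita_koszul {f : L → V} (hf : IsSurface f)
    {X Y Z : (p : L) → TangentSpace (𝓡 2) p} (hX : IsSmoothField X) (hY : IsSmoothField Y)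
    (hZ : IsSmoothField Z) (p : L) :
    2 * inducedMetric f (leviCivita f X Y) Z p =
      along X (inducedMetric f Y Z) p + along Y (inducedMetric f Z X) p
        - along Z (inducedMetric f X Y) p
        + inducedMetric f (mlieBracket (𝓡 2) X Y) Z p
        - inducedMetric f (mlieBracket (𝓡 2) Y Z) X p
        + inducedMetric f (mlieBracket (𝓡 2) Z X) Y p := by
  have h1 := leviCivita_metric hf X hY hZ p
  have h2 := leviCivita_metric hf Y hZ hX p
  have h3 := leviCivita_metric hf Z hX hY p
  have key : ∀ {A B : (p : L) → TangentSpace (𝓡 2) p}, IsSmoothField A → IsSmoothField B →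
      ∀ C : (p : L) → TangentSpace (𝓡 2) p, inducedMetric f (mlieBracket (𝓡 2) A B) C p =
        inducedMetric f (leviCivita f A B) C p - inducedMetric f (leviCivita f B A) C p := by
    intro A B hA hB C
    simp only [inducedMetric, along, ← leviCivita_torsion hf hA hB p, map_sub, inner_sub_left]
  have comm : ∀ A B : (p : L) → TangentSpace (𝓡 2) p,
      inducedMetric f A B p = inducedMetric f B A p := fun A B => real_inner_comm _ _
  rw [h1, h2, h3, key hX hY, key hY hZ, key hZ hX, comm Y (leviCivita f X Z),
    comm Z (leviCivita f Y X), comm X (leviCivita f Z Y)]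
  ring

end LeviCivita

end SurfaceGeometry

/-!
Let `X, Y` be an orthonormal principal frame of `h`. Writing `g = h_* X` and `N = h_* Y`, the
vanishing of `α_h(X, Y)` and orthonormality leave only `X N = -a g` and `Y g = -b N`, where `a =
⟨∇_X X, Y⟩` and `b = ⟨∇_Y Y, X⟩` vanish nowhere because the integral curves are nowhere geodesics.
Since `α_h(X, X) ≠ 0`, `g` is an immersion, and `X, -b⁻¹ Y` are the fields that make it a surface
of type `D`: see `IsGenericPrincipalFrame.isTypeD_along`.

Conversely, let `g` be of type `D` with fields `X, Y`, and `N = g_* Y`. The conditions `∇_X Y = 0`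
and `α_g(X, Y) = 0` say that `X N = λ g`, with `λ = -⟨X, Y⟩_g ≠ 0` (`along_along_eq_smul_self`). It
suffices to find a map `h` with `X h = r g` and `Y h = s N` for functions `r` and `s` without
zeros, since `g` and `N` are then the images of a principal frame of `h` with all the required
properties (`isGenericPrincipalFrame_of_along`); the normal bundle of `h` is flat by the Ricci equation
(`hasFlatNormalBundle_of_diagonal`). So everything comes down to solving these two equations for
`h`, `r`, `s` near a point (`exists_integral_of_frame`).

In the plane, `X` and `Y` are tangent to the coordinate lines of a chart `(u, v)`, made of first
integrals of `Y` and of `X` (`exists_firstIntegral`). With `∂_v g = σ N` and `∂_u N = γ g`, the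
one-form `r g du + s N dv` is closed as soon as `∂_u s = σ r` and `∂_v r = γ s`. This is a linear
Goursat problem (`exists_goursat`), and the Poincaré lemma (`exists_potential`) then gives `h`.

Both the first integrals, which come from the flow of a scalar differential equation
(`exists_smooth_flow`), and the Goursat problem start from a continuous solution of integral
equations found by contraction (`exists_continuous_solution`). Smoothness follows by
bootstrapping: the equations and their differentiated forms express both partial derivatives of a
solution by the solution itself, at the same order of differentiability (`contDiff_succ_of_partial`).
-/

namespace SurfaceGeometry

open Filter Topology MeasureTheory
open scoped BoundedContinuousFunction

/-! ### Functions of two variables and their partial derivatives -/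

section PartialDerivatives

variable {V : Type*} [NormedAddCommGroup V] [NormedSpace ℝ V]

theorem hasFDerivAt_of_partial {f fx fy : ℝ × ℝ → V}
    (hx : ∀ p : ℝ × ℝ, HasDerivAt (fun t => f (t, p.2)) (fx p) p.1)
    (hy : ∀ p : ℝ × ℝ, HasDerivAt (fun t => f (p.1, t)) (fy p) p.2)
    (cx : Continuous fx) (cy : Continuous fy) (p : ℝ × ℝ) :
    HasFDerivAt f ((ContinuousLinearMap.toSpanSingleton ℝ (fx p)).coprod
      (ContinuousLinearMap.toSpanSingleton ℝ (fy p))) p := by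
  have h := hasStrictFDerivAt_uncurry_coprod (𝕜 := ℝ) (u := p) (f := fun x y => f (x, y))
    (f₁ := fun x y => ContinuousLinearMap.toSpanSingleton ℝ (fx (x, y)))
    (f₂ := fun x y => ContinuousLinearMap.toSpanSingleton ℝ (fy (x, y)))
    (Eventually.of_forall fun v => (hx v).hasFDerivAt)
    (Eventually.of_forall fun v => (hy v).hasFDerivAt)
    (((ContinuousLinearMap.toSpanSingletonCLE (𝕜 := ℝ) (E := V)).continuous.comp cx).continuousAt)
    (((ContinuousLinearMap.toSpanSingletonCLE (𝕜 := ℝ) (E := V)).continuous.comp cy).continuousAt)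
  exact h.hasFDerivAt

/-- A function of two variables is of class `C^(k+1)` if its partial derivatives are of class
`C^k`. -/
theorem contDiff_succ_of_partial {f fx fy : ℝ × ℝ → V} {k : ℕ}
    (hx : ∀ p : ℝ × ℝ, HasDerivAt (fun t => f (t, p.2)) (fx p) p.1)
    (hy : ∀ p : ℝ × ℝ, HasDerivAt (fun t => f (p.1, t)) (fy p) p.2)
    (cx : ContDiff ℝ k fx) (cy : ContDiff ℝ k fy) : ContDiff ℝ (k + 1 : ℕ) f := by
  have h := hasFDerivAt_of_partial hx hy cx.continuous cy.continuous
  push_cast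
  refine contDiff_succ_iff_fderiv_apply.2 ⟨fun p => (h p).differentiableAt, by simp, fun v => ?_⟩
  have : (fun p => fderiv ℝ f p v) = fun p => v.1 • fx p + v.2 • fy p := by
    ext1 p
    rw [(h p).fderiv]
    simp
  rw [this]
  fun_prop

theorem hasDerivAt_fst {f : ℝ × ℝ → V} {p : ℝ × ℝ} (hf : DifferentiableAt ℝ f p) :
    HasDerivAt (fun t => f (t, p.2)) (fderiv ℝ f p (1, 0)) p.1 :=
  HasFDerivAt.comp_hasDerivAt (f := fun t : ℝ => (t, p.2)) p.1 hf.hasFDerivAt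
    ((hasDerivAt_id p.1).prodMk (hasDerivAt_const p.1 p.2))

theorem hasDerivAt_snd {f : ℝ × ℝ → V} {p : ℝ × ℝ} (hf : DifferentiableAt ℝ f p) :
    HasDerivAt (fun t => f (p.1, t)) (fderiv ℝ f p (0, 1)) p.2 :=
  HasFDerivAt.comp_hasDerivAt (f := fun t : ℝ => (p.1, t)) p.2 hf.hasFDerivAt
    ((hasDerivAt_const p.2 p.1).prodMk (hasDerivAt_id p.2))

end PartialDerivatives

/-! ### Primitives in one variable, depending smoothly on the other -/

section Primitive

variable {V : Type*} [NormedAddCommGroup V] [NormedSpace ℝ V]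

/-- The primitive of `F` in the first variable that vanishes on the axis `x = 0`. -/
noncomputable def primitiveFst (F : ℝ × ℝ → V) (p : ℝ × ℝ) : V := ∫ t in (0 : ℝ)..p.1, F (t, p.2)

theorem continuous_primitiveFst {F : ℝ × ℝ → V} (hF : Continuous F) :
    Continuous (primitiveFst F) := by
  unfold primitiveFst
  exact intervalIntegral.continuous_parametric_intervalIntegral_of_continuous
    (f := fun (p : ℝ × ℝ) t => F (t, p.2)) (by fun_prop) continuous_fst

theorem hasDerivAt_primitiveFst_fst [CompleteSpace V] {F : ℝ × ℝ → V} (hF : Continuous F)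
    (p : ℝ × ℝ) : HasDerivAt (fun t => primitiveFst F (t, p.2)) (F p) p.1 := by
  have hc : Continuous fun t => F (t, p.2) := by fun_prop
  exact intervalIntegral.integral_hasDerivAt_right (hc.intervalIntegrable _ _)
    hc.stronglyMeasurable.stronglyMeasurableAtFilter hc.continuousAt

theorem hasDerivAt_primitiveFst_snd {F F' : ℝ × ℝ → V} (hF : Continuous F) (hF' : Continuous F')
    (h : ∀ p : ℝ × ℝ, HasDerivAt (fun t => F (p.1, t)) (F' p) p.2) (p : ℝ × ℝ) :
    HasDerivAt (fun t => primitiveFst F (p.1, t)) (primitiveFst F' p) p.2 := by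
  obtain ⟨C, hC⟩ := (isCompact_uIcc (a := (0 : ℝ)) (b := p.1)).prod
    (isCompact_Icc (a := p.2 - 1) (b := p.2 + 1)) |>.exists_bound_of_continuousOn hF'.continuousOn
  refine (intervalIntegral.hasDerivAt_integral_of_dominated_loc_of_deriv_le
    (F := fun y t => F (t, y)) (F' := fun y t => F' (t, y)) (bound := fun _ => C)
    (Icc_mem_nhds (a := p.2 - 1) (b := p.2 + 1) (by linarith) (by linarith))
    (Eventually.of_forall fun y => ?_) ?_ ?_ ?_ ?_ ?_).2
  · exact (by fun_prop : Continuous fun t => F (t, y)).aestronglyMeasurable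
  · exact (by fun_prop : Continuous fun t => F (t, p.2)).intervalIntegrable _ _
  · exact (by fun_prop : Continuous fun t => F' (t, p.2)).aestronglyMeasurable
  · exact Eventually.of_forall fun t ht y hy => hC (t, y) ⟨uIoc_subset_uIcc ht, hy⟩
  · exact intervalIntegrable_const
  · exact Eventually.of_forall fun t _ y _ => h (t, y)

theorem contDiff_nat_primitiveFst [CompleteSpace V] {k : ℕ} :
    ∀ {F : ℝ × ℝ → V}, ContDiff ℝ k F → ContDiff ℝ k (primitiveFst F) := by
  induction k with
  | zero =>
    intro F hF
    exact contDiff_zero.2 (continuous_primitiveFst hF.continuous)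
  | succ k ih =>
    intro F hF
    have hd : ContDiff ℝ k (fun p => fderiv ℝ F p (0, 1)) :=
      (hF.fderiv_right (m := k) (by norm_cast)).clm_apply contDiff_const
    have hdiff : Differentiable ℝ F := hF.differentiable (by simp)
    exact contDiff_succ_of_partial (hasDerivAt_primitiveFst_fst hF.continuous)
      (hasDerivAt_primitiveFst_snd hF.continuous hd.continuous
        fun p => hasDerivAt_snd hdiff.differentiableAt)
      (hF.of_le (by norm_cast; omega)) (ih hd)

theorem contDiff_primitiveFst [CompleteSpace V] {F : ℝ × ℝ → V} (hF : ContDiff ℝ ∞ F) :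
    ContDiff ℝ ∞ (primitiveFst F) :=
  contDiff_infty.2 fun k => contDiff_nat_primitiveFst (contDiff_infty.1 hF k)

end Primitive

/-! ### Extension of germs of smooth maps -/

section Extension

variable {E V : Type*} [NormedAddCommGroup E] [NormedSpace ℝ E] [HasContDiffBump E]
  [NormedAddCommGroup V] [NormedSpace ℝ V]

/-- A germ of a smooth map extends to a smooth bounded map of arbitrarily small support, whose bound
does not depend on the size of the support. -/
theorem exists_contDiff_extension {f : E → V} {x : E} (hf : ∀ᶠ q in 𝓝 x, ContDiffAt ℝ ∞ f q) :
    ∃ M : ℝ, 0 ≤ M ∧ ∀ δ > 0, ∃ g : E → V, ContDiff ℝ ∞ g ∧ g =ᶠ[𝓝 x] f ∧ (∀ q, ‖g q‖ ≤ M) ∧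
      ∀ q, δ ≤ dist q x → g q = 0 := by
  refine ⟨‖f x‖ + 1, by positivity, fun δ hδ => ?_⟩
  have hb : ∀ᶠ q in 𝓝 x, ‖f q‖ < ‖f x‖ + 1 :=
    hf.self_of_nhds.continuousAt.norm.eventually_lt continuousAt_const (by simp)
  obtain ⟨ε, hε, hball⟩ := Metric.eventually_nhds_iff_ball.1 (hf.and hb)
  let χ : ContDiffBump x := ⟨min ε δ / 3, min ε δ / 2, by positivity, by
    have : 0 < min ε δ := by positivity
    linarith⟩
  have hout : χ.rOut < min ε δ := by
    have : 0 < min ε δ := by positivity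
    change min ε δ / 2 < _
    linarith
  refine ⟨fun q => χ q • f q, ?_, ?_, fun q => ?_, fun q hq => ?_⟩
  · refine contDiff_iff_contDiffAt.2 fun q => ?_
    by_cases hq : q ∈ Metric.ball x ε
    · exact χ.contDiffAt.smul (hball q hq).1
    · have : (fun q => χ q • f q) =ᶠ[𝓝 q] fun _ => 0 := by
        have hq' : q ∈ (Metric.closedBall x χ.rOut)ᶜ := by
          have h1 := min_le_left ε δ
          simp only [Metric.mem_ball, not_lt, mem_compl_iff, Metric.mem_closedBall, not_le] at hq ⊢
          linarith
        filter_upwards [Metric.isClosed_closedBall.isOpen_compl.mem_nhds hq'] with y hy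
        have : χ.rOut ≤ dist y x := by
          simp only [mem_compl_iff, Metric.mem_closedBall, not_le] at hy
          exact hy.le
        rw [χ.zero_of_le_dist this, zero_smul]
      exact contDiffAt_const.congr_of_eventuallyEq this
  · filter_upwards [χ.eventuallyEq_one] with q hq
    simp [hq]
  · by_cases hq : q ∈ Metric.ball x ε
    · beta_reduce
      rw [norm_smul, Real.norm_of_nonneg χ.nonneg]
      calc χ q * ‖f q‖ ≤ 1 * ‖f q‖ := by gcongr; exact χ.le_one
        _ ≤ _ := by rw [one_mul]; exact (hball q hq).2.le
    · have : χ.rOut ≤ dist q x := by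
        have h1 := min_le_left ε δ
        simp only [Metric.mem_ball, not_lt] at hq
        linarith
      beta_reduce
      rw [χ.zero_of_le_dist this, zero_smul, norm_zero]
      positivity
  · have : χ.rOut ≤ dist q x := by
      have h1 := min_le_right ε δ
      linarith
    beta_reduce
    rw [χ.zero_of_le_dist this, zero_smul]

end Extension

/-! ### A contracting system of integral equations in the plane -/

section FixedPoint

theorem norm_primitiveFst_le {V : Type*} [NormedAddCommGroup V] [NormedSpace ℝ V]
    {F : ℝ × ℝ → V} (hF : Continuous F) {δ C : ℝ} (hδ : 0 < δ)
    (hs : ∀ p : ℝ × ℝ, δ ≤ |p.1| → F p = 0) (hC : ∀ p, ‖F p‖ ≤ C) (p : ℝ × ℝ) :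
    ‖primitiveFst F p‖ ≤ 2 * δ * C := by
  have hc : Continuous fun t => F (t, p.2) := by fun_prop
  have hz : ∀ t, t ∉ Icc (-δ) δ → F (t, p.2) = 0 := by
    intro t ht
    refine hs _ (le_of_not_gt fun h => ht ?_)
    exact ⟨(abs_lt.1 h).1.le, (abs_lt.1 h).2.le⟩
  have hcs : HasCompactSupport fun t => F (t, p.2) :=
    HasCompactSupport.intro isCompact_Icc hz
  have hint := (hc.integrable_of_hasCompactSupport (μ := volume) hcs).norm
  calc ‖primitiveFst F p‖ ≤ ∫ t in uIoc 0 p.1, ‖F (t, p.2)‖ :=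
        intervalIntegral.norm_integral_le_integral_norm_uIoc
    _ ≤ ∫ t, ‖F (t, p.2)‖ :=
        setIntegral_le_integral hint (Eventually.of_forall fun _ => norm_nonneg _)
    _ = ∫ t in Icc (-δ) δ, ‖F (t, p.2)‖ :=
        (setIntegral_eq_integral_of_forall_compl_eq_zero fun t ht => by rw [hz t ht, norm_zero]).symm
    _ ≤ ‖∫ t in Icc (-δ) δ, ‖F (t, p.2)‖‖ := le_abs_self _
    _ ≤ C * (volume.real (Icc (-δ) δ)) :=
        norm_setIntegral_le_of_norm_le_const (by simp) fun t _ => by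
          rw [norm_norm]
          exact hC _
    _ = 2 * δ * C := by
        rw [Real.volume_real_Icc_of_le (by linarith)]
        ring

/-- A contracting system of two integral equations, one in each variable, has a continuous
solution. The kernels `A` and `B` are supported in a thin strip, which makes the integral operator
a contraction on the bounded continuous functions of the whole plane. -/
theorem exists_continuous_solution {A B : ℝ × ℝ → ℝ × ℝ → ℝ} {δ C K : ℝ} (hδ : 0 < δ)
    (cA : Continuous (Function.uncurry A)) (cB : Continuous (Function.uncurry B))
    (sA : ∀ p w, δ ≤ |p.1| → A p w = 0) (sB : ∀ p w, δ ≤ |p.2| → B p w = 0)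
    (bA : ∀ p, |A p 0| ≤ C) (bB : ∀ p, |B p 0| ≤ C)
    (lA : ∀ p w w', |A p w - A p w'| ≤ K * ‖w - w'‖)
    (lB : ∀ p w w', |B p w - B p w'| ≤ K * ‖w - w'‖) (hK : 2 * δ * K ≤ 1 / 2) :
    ∃ w : ℝ × ℝ → ℝ × ℝ, Continuous w ∧
      (∀ p, (w p).1 = primitiveFst (fun q => A q (w q)) p) ∧
      ∀ p, (w p).2 = primitiveFst (fun q => B q.swap (w q.swap)) p.swap := by
  have hK0 : 0 ≤ K := by
    have := (abs_nonneg _).trans (lA 0 (1, 0) 0)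
    have h1 : ‖((1 : ℝ), (0 : ℝ)) - 0‖ = 1 := by simp [Prod.norm_def]
    rwa [h1, mul_one] at this
  have cA' : ∀ w : (ℝ × ℝ) →ᵇ (ℝ × ℝ), Continuous fun q => A q (w q) := fun w =>
    cA.comp (continuous_id.prodMk w.continuous)
  have cB' : ∀ w : (ℝ × ℝ) →ᵇ (ℝ × ℝ), Continuous fun q : ℝ × ℝ => B q.swap (w q.swap) := fun w =>
    cB.comp (continuous_swap.prodMk (w.continuous.comp continuous_swap))
  have hbd : ∀ {D : ℝ × ℝ → ℝ × ℝ → ℝ}, (∀ p, |D p 0| ≤ C) →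
      (∀ p w w', |D p w - D p w'| ≤ K * ‖w - w'‖) →
      ∀ (w : (ℝ × ℝ) →ᵇ (ℝ × ℝ)) q, ‖D q (w q)‖ ≤ C + K * ‖w‖ := by
    intro D b l w q
    have h1 := l q (w q) 0
    have h2 := b q
    have h3 : K * ‖w q - 0‖ ≤ K * ‖w‖ := by
      rw [sub_zero]
      exact mul_le_mul_of_nonneg_left (w.norm_coe_le_norm q) hK0
    rw [Real.norm_eq_abs]
    calc |D q (w q)| = |D q 0 + (D q (w q) - D q 0)| := by rw [add_sub_cancel]
      _ ≤ |D q 0| + |D q (w q) - D q 0| := abs_add_le _ _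
      _ ≤ _ := by linarith
  let T (w : (ℝ × ℝ) →ᵇ (ℝ × ℝ)) : (ℝ × ℝ) →ᵇ (ℝ × ℝ) :=
    BoundedContinuousFunction.ofNormedAddCommGroup
      (fun p => (primitiveFst (fun q => A q (w q)) p,
        primitiveFst (fun q => B q.swap (w q.swap)) p.swap))
      ((continuous_primitiveFst (cA' w)).prodMk
        ((continuous_primitiveFst (cB' w)).comp continuous_swap))
      (2 * δ * (C + K * ‖w‖)) fun p => by
        refine max_le ?_ ?_
        · exact norm_primitiveFst_le (cA' w) hδ (fun q => sA _ _) (hbd bA lA w) p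
        · exact norm_primitiveFst_le (cB' w) hδ
            (fun q hq => sB q.swap _ hq) (fun q => hbd bB lB w q.swap) p.swap
  have hlip : ∀ w w' : (ℝ × ℝ) →ᵇ (ℝ × ℝ), dist (T w) (T w') ≤ (1 / 2 : NNReal) * dist w w' := by
    intro w w'
    refine (BoundedContinuousFunction.dist_le (by positivity)).2 fun p => ?_
    have key : ∀ {F G : ℝ × ℝ → ℝ}, Continuous F → Continuous G →
        (∀ p : ℝ × ℝ, δ ≤ |p.1| → F p = 0) → (∀ p : ℝ × ℝ, δ ≤ |p.1| → G p = 0) →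
        (∀ p, ‖F p - G p‖ ≤ K * dist w w') → ∀ p,
        dist (primitiveFst F p) (primitiveFst G p) ≤ (1 / 2 : NNReal) * dist w w' := by
      intro F G hF hG sF sG hFG p
      have hsub : primitiveFst F p - primitiveFst G p = primitiveFst (fun q => F q - G q) p :=
        (intervalIntegral.integral_sub
          ((by fun_prop : Continuous fun t => F (t, p.2)).intervalIntegrable _ _)
          ((by fun_prop : Continuous fun t => G (t, p.2)).intervalIntegrable _ _)).symm
      rw [dist_eq_norm, hsub]
      refine (norm_primitiveFst_le (hF.sub hG) hδ
        (fun q hq => by rw [Pi.sub_apply, sF q hq, sG q hq, sub_zero]) hFG p).trans ?_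
      rw [← mul_assoc]
      refine mul_le_mul_of_nonneg_right ?_ dist_nonneg
      simpa using hK
    have hww : ∀ q, ‖w q - w' q‖ ≤ dist w w' := fun q => by
      rw [← dist_eq_norm]
      exact w.dist_coe_le_dist q
    refine max_le ?_ ?_
    · exact key (cA' w) (cA' w') (fun q => sA _ _) (fun q => sA _ _)
        (fun q => (lA _ _ _).trans (mul_le_mul_of_nonneg_left (hww _) hK0)) p
    · exact key (cB' w) (cB' w') (fun q hq => sB q.swap _ hq) (fun q hq => sB q.swap _ hq)
        (fun q => (lB _ _ _).trans (mul_le_mul_of_nonneg_left (hww _) hK0)) p.swap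
  have hT : ContractingWith (1 / 2) T :=
    ⟨by rw [div_lt_one (by norm_num)]; norm_num, LipschitzWith.of_dist_le_mul hlip⟩
  have hfix : T (ContractingWith.fixedPoint T hT) = ContractingWith.fixedPoint T hT :=
    hT.fixedPoint_isFixedPt
  set w := ContractingWith.fixedPoint T hT
  exact ⟨w, w.continuous, fun p => congrArg Prod.fst (DFunLike.congr_fun hfix p).symm,
    fun p => congrArg Prod.snd (DFunLike.congr_fun hfix p).symm⟩

end FixedPoint

/-! ### The Goursat problem -/

section Goursat

/-- Bootstrap step for the hyperbolic system `s_x = α r`, `r_y = γ s`: the first equation gives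
`s_x`, and differentiating its integrated form in `y` and using the second one gives
`s_y = ∫ (α_y r + α γ s) dx`; both are as regular as `r` and `s`. -/
theorem contDiff_succ_of_goursat {α γ r s : ℝ × ℝ → ℝ} (hα : ContDiff ℝ ∞ α)
    (hγ : ContDiff ℝ ∞ γ) {c : ℝ} (hs : ∀ p, s p = c + primitiveFst (fun q => α q * r q) p)
    (hr : ∀ p : ℝ × ℝ, HasDerivAt (fun t => r (p.1, t)) (γ p * s p) p.2) {k : ℕ}
    (kr : ContDiff ℝ k r) (ks : ContDiff ℝ k s) : ContDiff ℝ (k + 1 : ℕ) s := by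
  have hαd : ContDiff ℝ ∞ (fun p => fderiv ℝ α p (0, 1)) :=
    (hα.fderiv_right (m := ∞) (by simp)).clm_apply contDiff_const
  have k1 : ContDiff ℝ k (fun q => α q * r q) := (contDiff_infty.1 hα k).mul kr
  have k2 : ContDiff ℝ k (fun q => fderiv ℝ α q (0, 1) * r q + α q * (γ q * s q)) :=
    ((contDiff_infty.1 hαd k).mul kr).add
      ((contDiff_infty.1 hα k).mul ((contDiff_infty.1 hγ k).mul ks))
  refine contDiff_succ_of_partial (fun p => ?_) (fun p => ?_) k1 (contDiff_nat_primitiveFst k2)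
  · simp only [hs]
    exact (hasDerivAt_primitiveFst_fst k1.continuous p).const_add c
  · simp only [show ∀ t, s (p.1, t) = c + primitiveFst (fun q => α q * r q) (p.1, t) from
      fun t => hs _]
    refine (hasDerivAt_primitiveFst_snd k1.continuous k2.continuous (fun q => ?_) p).const_add c
    exact (hasDerivAt_snd (hα.differentiable (by simp)).differentiableAt).mul (hr q)

/-- Differentiation of a primitive in the second variable. -/
theorem hasDerivAt_of_eq_primitive_swap {G r : ℝ × ℝ → ℝ} (hG : Continuous G) {c : ℝ}
    (h : ∀ p : ℝ × ℝ, r p = c + primitiveFst (fun q => G q.swap) p.swap) (p : ℝ × ℝ) :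
    HasDerivAt (fun t => r (p.1, t)) (G p) p.2 := by
  rw [funext h]
  exact (hasDerivAt_primitiveFst_fst (hG.comp continuous_swap) p.swap).const_add c

/-- Local solvability of the Goursat problem `s_x = α r`, `r_y = γ s`, `r(0) = s(0) = 1`, in the
smooth category. -/
theorem exists_goursat {α γ : ℝ × ℝ → ℝ} (hα : ∀ᶠ p in 𝓝 0, ContDiffAt ℝ ∞ α p)
    (hγ : ∀ᶠ p in 𝓝 0, ContDiffAt ℝ ∞ γ p) :
    ∃ r s : ℝ × ℝ → ℝ, ContDiff ℝ ∞ r ∧ ContDiff ℝ ∞ s ∧ r 0 = 1 ∧ s 0 = 1 ∧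
      (∀ᶠ p in 𝓝 (0 : ℝ × ℝ), fderiv ℝ s p (1, 0) = α p * r p) ∧
      ∀ᶠ p in 𝓝 (0 : ℝ × ℝ), fderiv ℝ r p (0, 1) = γ p * s p := by
  obtain ⟨M, hM, extα⟩ := exists_contDiff_extension hα
  obtain ⟨M', hM', extγ⟩ := exists_contDiff_extension hγ
  -- The bounds `M` and `M'` survive the cut-off, which makes the contraction constant at most `1 / 2`.
  set δ : ℝ := 1 / (4 * (M + M' + 1)) with hδ
  have hδ0 : 0 < δ := by positivity
  obtain ⟨a, ca, ea, ba, sa⟩ := extα δ hδ0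
  obtain ⟨g, cg, eg, bg, sg⟩ := extγ δ hδ0
  have sup : ∀ {f : ℝ × ℝ → ℝ}, (∀ q, δ ≤ dist q 0 → f q = 0) →
      (∀ p : ℝ × ℝ, δ ≤ |p.1| → f p = 0) ∧ ∀ p : ℝ × ℝ, δ ≤ |p.2| → f p = 0 := by
    refine fun h => ⟨fun p hp => h p ?_, fun p hp => h p ?_⟩
    · rw [dist_zero_right]
      exact hp.trans (le_max_left _ _)
    · rw [dist_zero_right]
      exact hp.trans (le_max_right _ _)
  have hac := ca.continuous
  have hgc := cg.continuous
  -- The first unknown is `s - 1` and the second one `r - 1`.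
  obtain ⟨w, cw, w1, w2⟩ := exists_continuous_solution (A := fun p w => a p * (1 + w.2))
    (B := fun p w => g p * (1 + w.1)) (C := M + M') (K := M + M') hδ0 (by fun_prop) (by fun_prop)
    (fun p w hp => by rw [(sup sa).1 p hp, zero_mul])
    (fun p w hp => by rw [(sup sg).2 p hp, zero_mul])
    (fun p => by
      have := ba p
      rw [Real.norm_eq_abs] at this
      simp
      linarith)
    (fun p => by
      have := bg p
      rw [Real.norm_eq_abs] at this
      simp
      linarith)
    (fun p w w' => by
      have h1 : ‖a p‖ ≤ M + M' := (ba p).trans (by linarith)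
      rw [← mul_sub, add_sub_add_left_eq_sub, abs_mul]
      exact mul_le_mul h1 (norm_snd_le (w - w')) (abs_nonneg _) (by positivity))
    (fun p w w' => by
      have h1 : ‖g p‖ ≤ M + M' := (bg p).trans (by linarith)
      rw [← mul_sub, add_sub_add_left_eq_sub, abs_mul]
      exact mul_le_mul h1 (norm_fst_le (w - w')) (abs_nonneg _) (by positivity))
    (by
      rw [hδ]
      have : 2 * (1 / (4 * (M + M' + 1))) * (M + M') = (M + M') / (M + M' + 1) * (1 / 2) := by
        field_simp
        ring
      rw [this]
      have h2 : (M + M') / (M + M' + 1) ≤ 1 := (div_le_one (by positivity)).2 (by linarith)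
      linarith)
  set r : ℝ × ℝ → ℝ := fun p => 1 + (w p).2 with hr
  set s : ℝ × ℝ → ℝ := fun p => 1 + (w p).1 with hs
  have es : ∀ p, s p = 1 + primitiveFst (fun q => a q * r q) p := fun p => congrArg (1 + ·) (w1 p)
  have er : ∀ p : ℝ × ℝ, r p = 1 + primitiveFst (fun q => g q.swap * s q.swap) p.swap :=
    fun p => congrArg (1 + ·) (w2 p)
  have cr : Continuous r := by fun_prop
  have cs : Continuous s := by fun_prop
  have dr : ∀ p : ℝ × ℝ, HasDerivAt (fun t => r (p.1, t)) (g p * s p) p.2 :=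
    hasDerivAt_of_eq_primitive_swap (G := fun q => g q * s q) (by fun_prop) er
  have ds : ∀ p : ℝ × ℝ, HasDerivAt (fun t => s (t, p.2)) (a p * r p) p.1 := fun p => by
    rw [funext es]
    exact (hasDerivAt_primitiveFst_fst (F := fun q => a q * r q) (by fun_prop) p).const_add 1
  have smooth : ∀ k : ℕ, ContDiff ℝ k r ∧ ContDiff ℝ k s := by
    intro k
    induction k with
    | zero => exact ⟨contDiff_zero.2 cr, contDiff_zero.2 cs⟩
    | succ k ih =>
      have hsw : ∀ {n : ℕ∞ω}, ContDiff ℝ n (Prod.swap : ℝ × ℝ → ℝ × ℝ) :=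
        contDiff_snd.prodMk contDiff_fst
      refine ⟨?_, contDiff_succ_of_goursat ca cg es dr ih.1 ih.2⟩
      -- The system is symmetric under exchange of the variables together with the unknowns.
      have := contDiff_succ_of_goursat (α := g ∘ Prod.swap) (γ := a ∘ Prod.swap)
        (r := s ∘ Prod.swap) (s := r ∘ Prod.swap) (cg.comp hsw) (ca.comp hsw)
        (fun p => er p.swap) (fun p => ds p.swap) (ih.2.comp hsw) (ih.1.comp hsw)
      exact this.comp hsw
  have kr : ContDiff ℝ ∞ r := contDiff_infty.2 fun k => (smooth k).1
  have ks : ContDiff ℝ ∞ s := contDiff_infty.2 fun k => (smooth k).2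
  refine ⟨r, s, kr, ks, ?_, ?_, ?_, ?_⟩
  · rw [er]
    simp [primitiveFst]
  · rw [es]
    simp [primitiveFst]
  · filter_upwards [ea] with p hp
    rw [← hp]
    exact (hasDerivAt_fst (ks.differentiable (by simp)).differentiableAt).unique (ds p)
  · filter_upwards [eg] with p hp
    rw [← hp]
    exact (hasDerivAt_snd (kr.differentiable (by simp)).differentiableAt).unique (dr p)

end Goursat

/-! ### The flow of a scalar ordinary differential equation -/

section Flow

/-- The mean value theorem in integral form. -/
theorem sub_eq_mul_integral_deriv {f f' : ℝ → ℝ} (h : ∀ t, HasDerivAt f (f' t) t)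
    (hf' : Continuous f') (a b : ℝ) :
    f a - f b = (a - b) * ∫ θ in (0 : ℝ)..1, f' (b + θ * (a - b)) := by
  have hd : ∀ θ ∈ uIcc (0 : ℝ) 1, HasDerivAt (fun θ => f (b + θ * (a - b)))
      (f' (b + θ * (a - b)) * (a - b)) θ := fun θ _ => by
    have h1 : HasDerivAt (fun θ : ℝ => b + θ * (a - b)) (a - b) θ := by
      simpa using ((hasDerivAt_id θ).mul_const (a - b)).const_add b
    exact (h _).comp θ h1
  have h2 := intervalIntegral.integral_eq_sub_of_hasDerivAt hd
    ((by fun_prop : Continuous fun θ => f' (b + θ * (a - b)) * (a - b)).intervalIntegrable 0 1)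
  rw [intervalIntegral.integral_mul_const] at h2
  rw [mul_comm, h2]
  congr 2 <;> ring

theorem eq_mul_exp_of_hasDerivAt {D c : ℝ → ℝ} (hc : Continuous c)
    (hD : ∀ t, HasDerivAt D (c t * D t) t) (x : ℝ) :
    D x = D 0 * Real.exp (∫ t in (0 : ℝ)..x, c t) := by
  have hI : ∀ x, HasDerivAt (fun x => ∫ t in (0 : ℝ)..x, c t) (c x) x := fun x =>
    intervalIntegral.integral_hasDerivAt_right (hc.intervalIntegrable _ _)
      hc.stronglyMeasurable.stronglyMeasurableAtFilter hc.continuousAt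
  have h : ∀ x, HasDerivAt (fun x => D x * Real.exp (-∫ t in (0 : ℝ)..x, c t)) 0 x := fun x => by
    have := (hD x).mul (hI x).neg.exp
    refine this.congr_deriv ?_
    ring
  have h2 := is_const_of_deriv_eq_zero (fun x => (h x).differentiableAt) (fun x => (h x).deriv) x 0
  simp only [intervalIntegral.integral_same, neg_zero, Real.exp_zero, mul_one] at h2
  rw [← h2, mul_assoc, ← Real.exp_add, neg_add_cancel, Real.exp_zero, mul_one]

variable {m φ : ℝ × ℝ → ℝ}

theorem hasDerivAt_flow_fst (hm : Continuous m) (cφ : Continuous φ)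
    (h : ∀ p, φ p = p.2 + primitiveFst (fun q => m (q.1, φ q)) p) (p : ℝ × ℝ) :
    HasDerivAt (fun t => φ (t, p.2)) (m (p.1, φ p)) p.1 := by
  have e : (fun t => φ (t, p.2)) = fun t => p.2 + primitiveFst (fun q => m (q.1, φ q)) (t, p.2) :=
    funext fun t => h _
  rw [e]
  exact (hasDerivAt_primitiveFst_fst (F := fun q => m (q.1, φ q)) (by fun_prop) p).const_add p.2

/-- The flow `φ` of the scalar equation `y' = m(x, y)` depends differentiably on the initial value:
the difference of two solutions satisfies a linear equation, so that its quotient by the difference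
of the initial values is an explicit exponential, continuous in the initial values. -/
theorem hasDerivAt_flow_snd (hm : ContDiff ℝ ∞ m) (cφ : Continuous φ)
    (h : ∀ p, φ p = p.2 + primitiveFst (fun q => m (q.1, φ q)) p) (p : ℝ × ℝ) :
    HasDerivAt (fun t => φ (p.1, t))
      (Real.exp (primitiveFst (fun q => fderiv ℝ m (q.1, φ q) (0, 1)) p)) p.2 := by
  have cm : Continuous fun q => fderiv ℝ m q (0, 1) :=
    ((hm.fderiv_right (m := ∞) (by simp)).clm_apply contDiff_const).continuous
  -- `c` is the divided difference of `m` in its second variable, between two solutions.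
  set c : ℝ × ℝ → ℝ := fun q => ∫ θ in (0 : ℝ)..1,
    fderiv ℝ m (q.1, φ (q.1, p.2) + θ * (φ q - φ (q.1, p.2))) (0, 1) with hc
  have cc : Continuous c :=
    intervalIntegral.continuous_parametric_intervalIntegral_of_continuous'
      (f := fun (q : ℝ × ℝ) θ => fderiv ℝ m (q.1, φ (q.1, p.2) + θ * (φ q - φ (q.1, p.2))) (0, 1))
      (cm.comp (f := fun z : (ℝ × ℝ) × ℝ =>
        (z.1.1, φ (z.1.1, p.2) + z.2 * (φ z.1 - φ (z.1.1, p.2)))) (by fun_prop)) 0 1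
  have h0 : ∀ y, φ (0, y) = y := fun y => by rw [h]; simp [primitiveFst]
  have hD : ∀ y, φ (p.1, y) - φ p = (y - p.2) * Real.exp (primitiveFst c (p.1, y)) := by
    intro y
    have key := eq_mul_exp_of_hasDerivAt (D := fun t => φ (t, y) - φ (t, p.2))
      (c := fun t => c (t, y)) (by fun_prop) (fun t => by
        refine ((hasDerivAt_flow_fst hm.continuous cφ h (t, y)).sub
          (hasDerivAt_flow_fst hm.continuous cφ h (t, p.2))).congr_deriv ?_
        have := sub_eq_mul_integral_deriv (f := fun y => m (t, y))
          (f' := fun y => fderiv ℝ m (t, y) (0, 1))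
          (fun y => hasDerivAt_snd (p := (t, y)) (hm.differentiable (by simp)).differentiableAt)
          (by fun_prop) (φ (t, y)) (φ (t, p.2))
        exact this.trans (mul_comm _ _)) p.1
    simp only [h0] at key
    exact key
  rw [hasDerivAt_iff_tendsto_slope]
  have hE : Continuous fun y => Real.exp (primitiveFst c (p.1, y)) :=
    Real.continuous_exp.comp ((continuous_primitiveFst cc).comp (by fun_prop))
  have hp : Real.exp (primitiveFst c (p.1, p.2))
      = Real.exp (primitiveFst (fun q => fderiv ℝ m (q.1, φ q) (0, 1)) p) := by
    simp [primitiveFst, hc]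
  rw [← hp]
  refine (hE.tendsto p.2).mono_left nhdsWithin_le_nhds |>.congr' ?_
  filter_upwards [self_mem_nhdsWithin] with y hy
  have hy' : y - p.2 ≠ 0 := sub_ne_zero.2 hy
  rw [slope_def_field, hD y]
  field_simp

/-- The partial derivatives of the flow are as regular as the flow, so that it is smooth. -/
theorem contDiff_flow (hm : ContDiff ℝ ∞ m) (cφ : Continuous φ)
    (h : ∀ p, φ p = p.2 + primitiveFst (fun q => m (q.1, φ q)) p) : ContDiff ℝ ∞ φ := by
  refine contDiff_infty.2 fun k => ?_
  induction k with
  | zero => exact contDiff_zero.2 cφ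
  | succ k ih =>
    have hmd : ContDiff ℝ k fun q => fderiv ℝ m q (0, 1) :=
      contDiff_infty.1 ((hm.fderiv_right (m := ∞) (by simp)).clm_apply contDiff_const) k
    exact contDiff_succ_of_partial (hasDerivAt_flow_fst hm.continuous cφ h)
      (hasDerivAt_flow_snd hm cφ h) ((contDiff_infty.1 hm k).comp (contDiff_fst.prodMk ih))
      (contDiff_nat_primitiveFst (hmd.comp (contDiff_fst.prodMk ih))).exp

/-- Smooth local flow of a scalar equation `y' = m(x, y)` near the origin. -/
theorem exists_smooth_flow (hm : ∀ᶠ p in 𝓝 0, ContDiffAt ℝ ∞ m p) :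
    ∃ φ : ℝ × ℝ → ℝ, ContDiff ℝ ∞ φ ∧ φ 0 = 0 ∧ fderiv ℝ φ 0 (0, 1) ≠ 0 ∧
      ∀ᶠ p in 𝓝 (0 : ℝ × ℝ), fderiv ℝ φ p (1, 0) = m (p.1, φ p) := by
  obtain ⟨M, hM, ext⟩ := exists_contDiff_extension hm
  obtain ⟨g, cg, eg, bg, sg⟩ := ext 1 one_pos
  have hgc : HasCompactSupport g := HasCompactSupport.intro (isCompact_closedBall 0 1)
    fun q hq => sg q (not_le.1 hq).le
  obtain ⟨K, hK⟩ := cg.lipschitzWith_of_hasCompactSupport hgc (by simp)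
  -- Cutting off in the first variable only keeps the Lipschitz constant `K` in the second one, so
  -- that a support of width `2 δ` makes the integral operator contract.
  set δ : ℝ := 1 / (4 * (K + 1)) with hδ
  have hδ0 : 0 < δ := by positivity
  let χ : ContDiffBump (0 : ℝ) := ⟨δ / 2, δ, by positivity, by linarith⟩
  set m' : ℝ × ℝ → ℝ := fun p => χ p.1 * g p with hm'
  have cm' : ContDiff ℝ ∞ m' := (χ.contDiff.comp contDiff_fst).mul cg
  have em' : m' =ᶠ[𝓝 0] m := by
    have h1 : ∀ᶠ p : ℝ × ℝ in 𝓝 0, χ p.1 = 1 :=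
      (continuous_fst.tendsto (0 : ℝ × ℝ)).eventually χ.eventuallyEq_one
    filter_upwards [h1, eg] with p hp hp'
    rw [hm']
    simp only [hp, hp', one_mul]
  have cm'c := cm'.continuous
  obtain ⟨w, cw, w1, -⟩ := exists_continuous_solution (A := fun p w => m' (p.1, p.2 + w.1))
    (B := fun _ _ => 0) (C := M) (K := K) hδ0 (by fun_prop) (by fun_prop)
    (fun p w hp => by
      have : χ p.1 = 0 := χ.zero_of_le_dist (by rwa [Real.dist_eq, sub_zero])
      simp [hm', this])
    (fun p w hp => rfl)
    (fun p => by
      rw [abs_mul, abs_of_nonneg χ.nonneg]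
      exact (mul_le_mul χ.le_one (bg _) (abs_nonneg _) zero_le_one).trans (by rw [one_mul]))
    (fun p => by simpa using hM)
    (fun p w w' => by
      rw [← mul_sub, abs_mul, abs_of_nonneg χ.nonneg]
      have h1 := hK.dist_le_mul (p.1, p.2 + w.1) (p.1, p.2 + w'.1)
      have h2 : dist (p.1, p.2 + w.1) (p.1, p.2 + w'.1) ≤ ‖w - w'‖ := by
        refine max_le (by simp) ?_
        rw [Real.dist_eq, add_sub_add_left_eq_sub]
        exact norm_fst_le (w - w')
      rw [Real.dist_eq] at h1
      exact (mul_le_of_le_one_left (abs_nonneg _) χ.le_one).trans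
        (h1.trans (mul_le_mul_of_nonneg_left h2 K.2)))
    (fun p w w' => by
      rw [sub_zero, abs_zero]
      positivity)
    (by
      rw [hδ]
      have : 2 * (1 / (4 * ((K : ℝ) + 1))) * K = K / (K + 1) * (1 / 2) := by
        field_simp
        ring
      rw [this]
      have h2 : (K : ℝ) / (K + 1) ≤ 1 := (div_le_one (by positivity)).2 (by linarith)
      linarith)
  set φ : ℝ × ℝ → ℝ := fun p => p.2 + (w p).1 with hφ
  have eφ : ∀ p, φ p = p.2 + primitiveFst (fun q => m' (q.1, φ q)) p :=
    fun p => congrArg (p.2 + ·) (w1 p)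
  have cφ : Continuous φ := by fun_prop
  have kφ : ContDiff ℝ ∞ φ := contDiff_flow cm' cφ eφ
  have φ0 : φ 0 = 0 := by rw [eφ]; simp [primitiveFst]
  have dφ := kφ.differentiable (by simp)
  refine ⟨φ, kφ, φ0, ?_, ?_⟩
  · have h1 := (hasDerivAt_snd dφ.differentiableAt).unique (hasDerivAt_flow_snd cm' cφ eφ 0)
    rw [h1]
    exact (Real.exp_pos _).ne'
  · have ht : Tendsto (fun p : ℝ × ℝ => (p.1, φ p)) (𝓝 0) (𝓝 0) := by
      have : Continuous fun p : ℝ × ℝ => (p.1, φ p) := by fun_prop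
      have h1 := this.tendsto 0
      rwa [φ0] at h1
    filter_upwards [ht.eventually em'] with p hp
    rw [← hp]
    exact (hasDerivAt_fst dφ.differentiableAt).unique (hasDerivAt_flow_fst cm'.continuous cφ eφ p)

end Flow

/-! ### First integrals of plane vector fields -/

section Coordinates

/-- Inverse function theorem on a neighbourhood, for smooth maps between spaces of the same finite
dimension. -/
theorem exists_smooth_localInverse {E F : Type*} [NormedAddCommGroup E] [NormedSpace ℝ E]
    [FiniteDimensional ℝ E] [NormedAddCommGroup F] [NormedSpace ℝ F] [FiniteDimensional ℝ F]
    (hEF : Module.finrank ℝ E = Module.finrank ℝ F) {f : E → F} {x : E}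
    (hf : ∀ᶠ q in 𝓝 x, ContDiffAt ℝ ∞ f q) (hinj : Function.Injective (fderiv ℝ f x)) :
    ∃ g : F → E, g (f x) = x ∧ (∀ᶠ y in 𝓝 (f x), ContDiffAt ℝ ∞ g y) ∧
      (∀ᶠ y in 𝓝 (f x), f (g y) = y) ∧ ∀ᶠ q in 𝓝 x, g (f q) = q := by
  have : CompleteSpace E := FiniteDimensional.complete ℝ E
  let e : E ≃L[ℝ] F := (LinearEquiv.ofInjectiveOfFinrankEq (fderiv ℝ f x).toLinearMap hinj hEF)
    |>.toContinuousLinearEquiv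
  have he : (e : E →L[ℝ] F) = fderiv ℝ f x := by
    ext v
    rfl
  have hfx : ContDiffAt ℝ ∞ f x := hf.self_of_nhds
  have hd : HasFDerivAt f (e : E →L[ℝ] F) x := by
    rw [he]
    exact (hfx.differentiableAt (by simp)).hasFDerivAt
  let R := hfx.toOpenPartialHomeomorph f hd (by simp)
  have hxs : x ∈ R.source := hfx.mem_toOpenPartialHomeomorph_source hd (by simp)
  have hgx : R.symm (f x) = x := R.left_inv hxs
  have hxt : f x ∈ R.target := R.map_source hxs
  have hev : ∀ᶠ q in 𝓝 x, fderiv ℝ f q ∈ range ((↑) : (E ≃L[ℝ] F) → E →L[ℝ] F) := by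
    have hc : ContinuousAt (fderiv ℝ f) x := (hfx.fderiv_right (m := 0) (by simp)).continuousAt
    refine hc.eventually_mem ?_
    rw [← he]
    exact ContinuousLinearEquiv.nhds e
  have hcont : Tendsto R.symm (𝓝 (f x)) (𝓝 x) := by
    have := R.continuousAt_symm hxt
    rwa [ContinuousAt, hgx] at this
  refine ⟨R.symm, hgx, ?_, ?_, ?_⟩
  · filter_upwards [hcont.eventually (hf.and hev), R.open_target.mem_nhds hxt] with y ⟨h1, e', h2⟩ hy
    refine R.contDiffAt_symm (f₀' := e') hy ?_ h1
    rw [h2]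
    exact (h1.differentiableAt (by simp)).hasFDerivAt
  · filter_upwards [R.open_target.mem_nhds hxt] with y hy using R.right_inv hy
  · filter_upwards [R.open_source.mem_nhds hxs] with q hq using R.left_inv hq

/-- A plane vector field that is transversal to the second axis at the origin has a smooth first
integral there: the initial value, on the second axis, of the integral curve through a point. -/
theorem exists_firstIntegral_prod {P : ℝ × ℝ → ℝ × ℝ} (hP : ∀ᶠ p in 𝓝 0, ContDiffAt ℝ ∞ P p)
    (hP0 : (P 0).1 ≠ 0) :
    ∃ v : ℝ × ℝ → ℝ, (∀ᶠ p in 𝓝 0, ContDiffAt ℝ ∞ v p) ∧ v 0 = 0 ∧ fderiv ℝ v 0 ≠ 0 ∧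
      ∀ᶠ p in 𝓝 0, fderiv ℝ v p (P p) = 0 := by
  have hne : ∀ᶠ p in 𝓝 0, (P p).1 ≠ 0 :=
    (continuous_fst.continuousAt.comp hP.self_of_nhds.continuousAt).eventually_ne hP0
  obtain ⟨φ, kφ, φ0, dφ0, eφ⟩ := exists_smooth_flow (m := fun p => (P p).2 / (P p).1) (by
    filter_upwards [hP, hne] with p hp hp'
    exact (contDiffAt_snd.comp p hp).div (contDiffAt_fst.comp p hp) hp')
  have dφ := kφ.differentiable (by simp)
  let Ψ : ℝ × ℝ → ℝ × ℝ := fun p => (p.1, φ p)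
  have kΨ : ContDiff ℝ ∞ Ψ := contDiff_fst.prodMk kφ
  have dΨ : ∀ p w, fderiv ℝ Ψ p w = (w.1, fderiv ℝ φ p w) := fun p w => by
    have : HasFDerivAt Ψ _ p := hasFDerivAt_fst.prodMk dφ.differentiableAt.hasFDerivAt
    rw [this.fderiv]
    rfl
  have Ψ0 : Ψ 0 = 0 := Prod.ext rfl φ0
  have split : ∀ (L : ℝ × ℝ →L[ℝ] ℝ) (w : ℝ × ℝ), L w = w.1 * L (1, 0) + w.2 * L (0, 1) := by
    intro L w
    have : w = w.1 • (1, 0) + w.2 • (0, 1) := by ext <;> simp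
    conv_lhs => rw [this, map_add, map_smul, map_smul]
    rfl
  obtain ⟨g, g0, kg, hg, -⟩ := exists_smooth_localInverse (f := Ψ) (x := 0) rfl
    (Eventually.of_forall fun p => kΨ.contDiffAt) (by
      rw [injective_iff_map_eq_zero]
      intro w hw
      rw [dΨ] at hw
      have h1 : w.1 = 0 := congrArg Prod.fst hw
      have h2 : fderiv ℝ φ 0 w = 0 := congrArg Prod.snd hw
      rw [split, h1, zero_mul, zero_add] at h2
      exact Prod.ext h1 ((mul_eq_zero.1 h2).resolve_right dφ0))
  rw [Ψ0] at g0 kg hg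
  have tg : Tendsto g (𝓝 0) (𝓝 0) := by
    have := kg.self_of_nhds.continuousAt
    rwa [ContinuousAt, g0] at this
  have hgd : ∀ᶠ y in 𝓝 (0 : ℝ × ℝ), ∀ w,
      (fderiv ℝ g y w).1 = w.1 ∧ fderiv ℝ φ (g y) (fderiv ℝ g y w) = w.2 := by
    filter_upwards [hg.eventually_nhds, kg] with y hy hk w
    have h1 : fderiv ℝ (Ψ ∘ g) y = ContinuousLinearMap.id ℝ _ := by
      have : Ψ ∘ g =ᶠ[𝓝 y] id := hy
      rw [this.fderiv_eq, fderiv_id]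
    rw [fderiv_comp y (kΨ.differentiable (by simp)).differentiableAt
      (hk.differentiableAt (by simp))] at h1
    have h2 : fderiv ℝ Ψ (g y) (fderiv ℝ g y w) = w := DFunLike.congr_fun h1 w
    rw [dΨ] at h2
    have h3 := congrArg Prod.fst h2
    have h4 := congrArg Prod.snd h2
    exact ⟨h3, h4⟩
  have dv : ∀ y, ContDiffAt ℝ ∞ g y → ∀ w,
      fderiv ℝ (fun p => (g p).2) y w = (fderiv ℝ g y w).2 := fun y hy w => by
    rw [fderiv.snd (hy.differentiableAt (by simp))]
    rfl
  refine ⟨fun p => (g p).2, ?_, by beta_reduce; rw [g0]; rfl, fun h0 => ?_, ?_⟩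
  · filter_upwards [kg] with y hy using contDiffAt_snd.comp y hy
  · have h1 := dv 0 kg.self_of_nhds (0, 1)
    rw [h0] at h1
    obtain ⟨h2, h3⟩ := hgd.self_of_nhds (0, 1)
    rw [split, h2, ← h1] at h3
    simp at h3
  · have near : ∀ᶠ y in 𝓝 (0 : ℝ × ℝ), fderiv ℝ φ (g y) (0, 1) ≠ 0 := by
      have : Continuous fun p => fderiv ℝ φ p (0, 1) :=
        ((kφ.fderiv_right (m := ∞) (by simp)).clm_apply contDiff_const).continuous
      exact tg.eventually (this.continuousAt.eventually_ne dφ0)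
    filter_upwards [hgd, kg, hne, near, tg.eventually eφ, hg] with y h1 h2 h3 h4 h5 h6
    obtain ⟨h7, h8⟩ := h1 (P y)
    have h9 : ((g y).1, φ (g y)) = y := h6
    rw [h9] at h5
    rw [split, h7, h5, mul_div_cancel₀ _ h3, add_eq_left] at h8
    rw [dv y h2]
    exact (mul_eq_zero.1 h8).resolve_right h4

end Coordinates

/-! ### Integration in coordinates adapted to a pair of vector fields -/

section Planar

/-- Poincaré lemma for the germ of a smooth vector-valued one-form `A dx + B dy` in the plane. -/
theorem exists_potential {V : Type*} [NormedAddCommGroup V] [NormedSpace ℝ V] [CompleteSpace V]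
    {A B : ℝ × ℝ → V} (hA : ∀ᶠ p in 𝓝 0, ContDiffAt ℝ ∞ A p)
    (hB : ∀ᶠ p in 𝓝 0, ContDiffAt ℝ ∞ B p)
    (h : ∀ᶠ p in 𝓝 0, fderiv ℝ A p (0, 1) = fderiv ℝ B p (1, 0)) :
    ∃ H : ℝ × ℝ → V, ContDiff ℝ ∞ H ∧
      ∀ᶠ p in 𝓝 0, fderiv ℝ H p (1, 0) = A p ∧ fderiv ℝ H p (0, 1) = B p := by
  obtain ⟨_, _, extA⟩ := exists_contDiff_extension hA
  obtain ⟨_, _, extB⟩ := exists_contDiff_extension hB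
  obtain ⟨a, ka, ea, -, -⟩ := extA 1 one_pos
  obtain ⟨b, kb, eb, -, -⟩ := extB 1 one_pos
  have da := ka.differentiable (by simp)
  have db := kb.differentiable (by simp)
  have ca : Continuous fun p => fderiv ℝ a p (0, 1) :=
    ((ka.fderiv_right (m := ∞) (by simp)).clm_apply contDiff_const).continuous
  have cb : Continuous fun p => fderiv ℝ b p (1, 0) :=
    ((kb.fderiv_right (m := ∞) (by simp)).clm_apply contDiff_const).continuous
  have kb0 : ContDiff ℝ ∞ fun q : ℝ × ℝ => b (0, q.1) :=
    kb.comp (contDiff_const.prodMk contDiff_fst)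
  set H : ℝ × ℝ → V := fun p => primitiveFst a p + primitiveFst (fun q => b (0, q.1)) (p.2, 0)
    with hH
  have kH : ContDiff ℝ ∞ H := (contDiff_primitiveFst ka).add
    ((contDiff_primitiveFst kb0).comp (contDiff_snd.prodMk contDiff_const))
  have dH := kH.differentiable (by simp)
  refine ⟨H, kH, ?_⟩
  have hab : ∀ᶠ p in 𝓝 (0 : ℝ × ℝ), fderiv ℝ a p (0, 1) = fderiv ℝ b p (1, 0) := by
    filter_upwards [h, ea.eventually_nhds, eb.eventually_nhds] with p hp h1 h2
    rw [EventuallyEq.fderiv_eq h1, EventuallyEq.fderiv_eq h2, hp]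
  obtain ⟨ε, hε, hball⟩ := Metric.eventually_nhds_iff_ball.1 hab
  filter_upwards [ea, eb, Metric.ball_mem_nhds (0 : ℝ × ℝ) hε] with p hpa hpb hp
  rw [← hpa, ← hpb]
  constructor
  · refine (hasDerivAt_fst dH.differentiableAt).unique ?_
    exact (hasDerivAt_primitiveFst_fst ka.continuous p).add_const
      (primitiveFst (fun q => b (0, q.1)) (p.2, 0))
  · refine (hasDerivAt_snd dH.differentiableAt).unique ?_
    have h1 := (hasDerivAt_primitiveFst_snd ka.continuous ca
      (fun q => hasDerivAt_snd da.differentiableAt) p).add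
      (hasDerivAt_primitiveFst_fst kb0.continuous (p.2, 0))
    refine h1.congr_deriv ?_
    have hint : primitiveFst (fun q => fderiv ℝ a q (0, 1)) p
        = ∫ t in (0 : ℝ)..p.1, fderiv ℝ b (t, p.2) (1, 0) := by
      refine intervalIntegral.integral_congr fun t ht => hball (t, p.2) ?_
      rw [Metric.mem_ball, dist_zero_right] at hp ⊢
      refine lt_of_le_of_lt ?_ hp
      refine max_le_max ?_ le_rfl
      have := abs_sub_left_of_mem_uIcc ht
      simpa using this
    rw [hint, intervalIntegral.integral_eq_sub_of_hasDerivAt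
      (f := fun t => b (t, p.2)) (fun t _ => hasDerivAt_fst (p := (t, p.2)) db.differentiableAt)
      ((by fun_prop : Continuous fun t => fderiv ℝ b (t, p.2) (1, 0)).intervalIntegrable _ _)]
    exact sub_add_cancel _ _

variable {E : Type*} [NormedAddCommGroup E] [NormedSpace ℝ E]

theorem exists_equiv_of_linearIndependent (hE : Module.finrank ℝ E = 2) {X Y : E}
    (h : LinearIndependent ℝ ![X, Y]) :
    ∃ T : (ℝ × ℝ) ≃L[ℝ] E, ∀ p, T p = p.1 • X + p.2 • Y := by
  have : FiniteDimensional ℝ E := Module.finite_of_finrank_pos (by omega)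
  let S : (ℝ × ℝ) →ₗ[ℝ] E :=
    (LinearMap.toSpanSingleton ℝ E X).coprod (LinearMap.toSpanSingleton ℝ E Y)
  have hS : ∀ p, S p = p.1 • X + p.2 • Y := fun p => by simp [S]
  have hinj : Function.Injective S := by
    rw [injective_iff_map_eq_zero]
    intro p hp
    rw [hS] at hp
    have := LinearIndependent.pair_iff.1 h p.1 p.2 hp
    exact Prod.ext this.1 this.2
  exact ⟨(LinearEquiv.ofInjectiveOfFinrankEq S hinj (by simp [hE])).toContinuousLinearEquiv, hS⟩

/-- Existence of a smooth first integral of a smooth vector field near a point where it does not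
vanish, in a plane; its differential does not vanish on a given transversal vector `Y`. -/
theorem exists_firstIntegral (hE : Module.finrank ℝ E = 2) {P : E → E} {x Y : E}
    (hP : ∀ᶠ q in 𝓝 x, ContDiffAt ℝ ∞ P q) (h : LinearIndependent ℝ ![P x, Y]) :
    ∃ v : E → ℝ, (∀ᶠ q in 𝓝 x, ContDiffAt ℝ ∞ v q) ∧ v x = 0 ∧ fderiv ℝ v x Y ≠ 0 ∧
      ∀ᶠ q in 𝓝 x, fderiv ℝ v q (P q) = 0 := by
  obtain ⟨T, hT⟩ := exists_equiv_of_linearIndependent hE h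
  have hT0 : Tendsto (fun p : ℝ × ℝ => x + T p) (𝓝 0) (𝓝 x) := by
    have : Continuous fun p : ℝ × ℝ => x + T p := by fun_prop
    simpa using this.tendsto 0
  have hTs : Tendsto (fun q : E => T.symm (q - x)) (𝓝 x) (𝓝 0) := by
    have : Continuous fun q : E => T.symm (q - x) := by fun_prop
    simpa using this.tendsto x
  have kT : ContDiff ℝ ∞ fun p : ℝ × ℝ => x + T p := contDiff_const.add T.contDiff
  have kTs : ContDiff ℝ ∞ fun q : E => T.symm (q - x) :=
    T.symm.contDiff.comp (contDiff_id.sub contDiff_const)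
  have hPx : T (1, 0) = P x := by simp [hT]
  obtain ⟨v, kv, v0, dv0, hv⟩ := exists_firstIntegral_prod (P := fun p => T.symm (P (x + T p))) (by
      filter_upwards [hT0.eventually hP] with p hp
      exact T.symm.contDiff.contDiffAt.comp p (hp.comp p kT.contDiffAt)) (by
    simp [← hPx])
  have hd : ∀ q, ContDiffAt ℝ ∞ v (T.symm (q - x)) → ∀ w,
      fderiv ℝ (fun q => v (T.symm (q - x))) q w = fderiv ℝ v (T.symm (q - x)) (T.symm w) := by
    intro q hq w
    have h1 : HasFDerivAt (fun q : E => T.symm (q - x)) (T.symm : E →L[ℝ] ℝ × ℝ) q :=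
      (T.symm : E →L[ℝ] ℝ × ℝ).hasFDerivAt.comp q ((hasFDerivAt_id q).sub_const x)
    have h2 := (hq.differentiableAt (by simp)).hasFDerivAt.comp q h1
    exact DFunLike.congr_fun h2.fderiv w
  have hlast : ∀ᶠ q in 𝓝 x, fderiv ℝ (fun q => v (T.symm (q - x))) q (P q) = 0 := by
    filter_upwards [hTs.eventually kv, hTs.eventually hv] with q h1 h2
    rw [hd q h1]
    simpa using h2
  refine ⟨fun q => v (T.symm (q - x)), ?_, by simp [v0], fun h0 => dv0 ?_, hlast⟩
  · filter_upwards [hTs.eventually kv] with q hq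
    exact hq.comp q kTs.contDiffAt
  · have hx := hlast.self_of_nhds
    have kv0 : ContDiffAt ℝ ∞ v (T.symm (x - x)) := by simpa using kv.self_of_nhds
    rw [hd x kv0, sub_self, map_zero] at hx h0
    ext1 <;> ext1
    · simpa [← hPx] using hx
    · have hY : T (0, 1) = Y := by simp [hT]
      simpa [← hY] using h0

/-- Two transversal plane vector fields are tangent to the coordinate lines of a chart. In such
coordinates the equations `P H = r G`, `Q H = s N`, where `P N = λ G` and `Q G = N`, have as
integrability condition a Goursat problem for `r` and `s`, so that they are solvable. -/
theorem exists_integral_of_frame {V : Type*} [NormedAddCommGroup V] [NormedSpace ℝ V]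
    [CompleteSpace V] (hE : Module.finrank ℝ E = 2) {P Q : E → E} {G N : E → V} {lam : E → ℝ}
    {x : E}
    (hP : ∀ᶠ q in 𝓝 x, ContDiffAt ℝ ∞ P q) (hQ : ∀ᶠ q in 𝓝 x, ContDiffAt ℝ ∞ Q q)
    (hG : ∀ᶠ q in 𝓝 x, ContDiffAt ℝ ∞ G q) (hN : ∀ᶠ q in 𝓝 x, ContDiffAt ℝ ∞ N q)
    (hlam : ∀ᶠ q in 𝓝 x, ContDiffAt ℝ ∞ lam q) (hPQ : LinearIndependent ℝ ![P x, Q x])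
    (hPN : ∀ᶠ q in 𝓝 x, fderiv ℝ N q (P q) = lam q • G q)
    (hQG : ∀ᶠ q in 𝓝 x, fderiv ℝ G q (Q q) = N q) :
    ∃ (H : E → V) (r s : E → ℝ), (∀ᶠ q in 𝓝 x, ContDiffAt ℝ ∞ H q) ∧
      (∀ᶠ q in 𝓝 x, ContDiffAt ℝ ∞ r q) ∧ (∀ᶠ q in 𝓝 x, ContDiffAt ℝ ∞ s q) ∧
      r x ≠ 0 ∧ s x ≠ 0 ∧ (∀ᶠ q in 𝓝 x, fderiv ℝ H q (P q) = r q • G q) ∧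
      ∀ᶠ q in 𝓝 x, fderiv ℝ H q (Q q) = s q • N q := by
  have : FiniteDimensional ℝ E := Module.finite_of_finrank_pos (by omega)
  obtain ⟨v, kv, v0, dv, vP⟩ := exists_firstIntegral hE hP hPQ
  obtain ⟨u, ku, u0, du, uQ⟩ := exists_firstIntegral hE hQ (LinearIndependent.pair_symm_iff.1 hPQ)
  set π : E → ℝ := fun q => fderiv ℝ u q (P q) with hπ
  set κ : E → ℝ := fun q => fderiv ℝ v q (Q q) with hκ
  have kπ : ∀ᶠ q in 𝓝 x, ContDiffAt ℝ ∞ π q := by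
    filter_upwards [ku, hP] with q h1 h2
    exact (h1.fderiv_right (m := ∞) (by simp)).clm_apply h2
  have kκ : ∀ᶠ q in 𝓝 x, ContDiffAt ℝ ∞ κ q := by
    filter_upwards [kv, hQ] with q h1 h2
    exact (h1.fderiv_right (m := ∞) (by simp)).clm_apply h2
  have nπ : ∀ᶠ q in 𝓝 x, π q ≠ 0 := kπ.self_of_nhds.continuousAt.eventually_ne du
  have nκ : ∀ᶠ q in 𝓝 x, κ q ≠ 0 := kκ.self_of_nhds.continuousAt.eventually_ne dv
  let χ : E → ℝ × ℝ := fun q => (u q, v q)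
  have kχ : ∀ᶠ q in 𝓝 x, ContDiffAt ℝ ∞ χ q := by
    filter_upwards [ku, kv] with q h1 h2 using h1.prodMk h2
  have dχ : ∀ᶠ q in 𝓝 x, ∀ w, fderiv ℝ χ q w = (fderiv ℝ u q w, fderiv ℝ v q w) := by
    filter_upwards [ku, kv] with q h1 h2 w
    have := (h1.differentiableAt (by simp)).hasFDerivAt.prodMk
      (h2.differentiableAt (by simp)).hasFDerivAt
    exact DFunLike.congr_fun this.fderiv w
  have χx : χ x = 0 := Prod.ext u0 v0
  obtain ⟨Φ, Φ0, kΦ, hΦ, hΦ'⟩ := exists_smooth_localInverse (f := χ) (x := x) (by simp [hE]) kχ (by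
    obtain ⟨T, hT⟩ := exists_equiv_of_linearIndependent hE hPQ
    rw [injective_iff_map_eq_zero]
    intro w hw
    obtain ⟨c, rfl⟩ := T.surjective w
    rw [dχ.self_of_nhds, hT] at hw
    have h1 := congrArg Prod.fst hw
    have h2 := congrArg Prod.snd hw
    simp only [map_add, map_smul, uQ.self_of_nhds, vP.self_of_nhds, smul_zero, add_zero, zero_add,
      Prod.fst_zero, Prod.snd_zero] at h1 h2
    have hc : c = 0 :=
      Prod.ext ((smul_eq_zero.1 h1).resolve_right du) ((smul_eq_zero.1 h2).resolve_right dv)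
    rw [hc, map_zero])
  rw [χx] at Φ0 kΦ hΦ
  have tΦ : Tendsto Φ (𝓝 0) (𝓝 x) := by
    have := kΦ.self_of_nhds.continuousAt
    rwa [ContinuousAt, Φ0] at this
  have tχ : Tendsto χ (𝓝 x) (𝓝 0) := by
    have := kχ.self_of_nhds.continuousAt
    rwa [ContinuousAt, χx] at this
  -- The coordinate fields are `P / π` and `Q / κ`.
  have coord : ∀ᶠ y in 𝓝 (0 : ℝ × ℝ), fderiv ℝ Φ y (1, 0) = (π (Φ y))⁻¹ • P (Φ y) ∧
      fderiv ℝ Φ y (0, 1) = (κ (Φ y))⁻¹ • Q (Φ y) := by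
    filter_upwards [hΦ, kΦ, tΦ.eventually hΦ'.eventually_nhds, tΦ.eventually kχ, tΦ.eventually dχ,
      tΦ.eventually uQ, tΦ.eventually vP, tΦ.eventually nπ, tΦ.eventually nκ]
      with y h1 h2 h3 h4 h5 h6 h7 h8 h9
    have h10 : ∀ w, fderiv ℝ Φ y (fderiv ℝ χ (Φ y) w) = w := by
      intro w
      have e1 : Φ ∘ χ =ᶠ[𝓝 (Φ y)] id := h3
      have e2 : fderiv ℝ (Φ ∘ χ) (Φ y) = _ := fderiv_comp _
        (show DifferentiableAt ℝ Φ (χ (Φ y)) by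
          rw [h1]
          exact h2.differentiableAt (by simp)) (h4.differentiableAt (by simp))
      have e3 := DFunLike.congr_fun (e1.fderiv_eq.symm.trans e2) w
      rw [fderiv_id, ContinuousLinearMap.comp_apply, h1] at e3
      exact e3.symm
    constructor
    · have e3 := h10 (P (Φ y))
      rw [h5, h7] at e3
      have e4 : (fderiv ℝ u (Φ y) (P (Φ y)), (0 : ℝ)) = π (Φ y) • (1, 0) := by ext <;> simp [hπ]
      rw [e4, map_smul] at e3
      rw [← e3, inv_smul_smul₀ h8]
    · have e3 := h10 (Q (Φ y))
      rw [h5, h6] at e3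
      have e4 : ((0 : ℝ), fderiv ℝ v (Φ y) (Q (Φ y))) = κ (Φ y) • (0, 1) := by ext <;> simp [hκ]
      rw [e4, map_smul] at e3
      rw [← e3, inv_smul_smul₀ h9]
  obtain ⟨r, s, kr, ks, r0, s0, hs, hr⟩ := exists_goursat (α := fun y => (κ (Φ y))⁻¹)
    (γ := fun y => lam (Φ y) * (π (Φ y))⁻¹) (by
      filter_upwards [kΦ, tΦ.eventually kκ, tΦ.eventually nκ] with y h1 h2 h3
      exact (h2.comp y h1).inv h3) (by
      filter_upwards [kΦ, tΦ.eventually kπ, tΦ.eventually nπ, tΦ.eventually hlam] with y h1 h2 h3 h4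
      exact (h4.comp y h1).mul ((h2.comp y h1).inv h3))
  have dr := kr.differentiable (by simp)
  have ds := ks.differentiable (by simp)
  have kGΦ : ∀ᶠ y in 𝓝 0, ContDiffAt ℝ ∞ (fun y => G (Φ y)) y := by
    filter_upwards [kΦ, tΦ.eventually hG] with y h1 h2 using h2.comp y h1
  have kNΦ : ∀ᶠ y in 𝓝 0, ContDiffAt ℝ ∞ (fun y => N (Φ y)) y := by
    filter_upwards [kΦ, tΦ.eventually hN] with y h1 h2 using h2.comp y h1
  obtain ⟨H, kH, hH⟩ := exists_potential (A := fun y => r y • G (Φ y)) (B := fun y => s y • N (Φ y))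
    (by filter_upwards [kGΦ] with y hy using kr.contDiffAt.smul hy)
    (by filter_upwards [kNΦ] with y hy using ks.contDiffAt.smul hy) (by
      filter_upwards [kGΦ, kNΦ, hs, hr, coord, kΦ, tΦ.eventually hG, tΦ.eventually hN,
        tΦ.eventually hPN, tΦ.eventually hQG] with y h1 h2 h3 h4 h5 h6 h7 h8 h9 h10
      have e1 : fderiv ℝ (fun y => G (Φ y)) y (0, 1) = (κ (Φ y))⁻¹ • N (Φ y) := by
        have := fderiv_comp y (h7.differentiableAt (by simp)) (h6.differentiableAt (by simp))
        refine (DFunLike.congr_fun this (0, 1)).trans ?_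
        rw [ContinuousLinearMap.comp_apply, h5.2, map_smul, h10]
      have e2 : fderiv ℝ (fun y => N (Φ y)) y (1, 0) = (π (Φ y))⁻¹ • lam (Φ y) • G (Φ y) := by
        have := fderiv_comp y (h8.differentiableAt (by simp)) (h6.differentiableAt (by simp))
        refine (DFunLike.congr_fun this (1, 0)).trans ?_
        rw [ContinuousLinearMap.comp_apply, h5.1, map_smul, h9]
      rw [fderiv_fun_smul dr.differentiableAt (h1.differentiableAt (by simp)),
        fderiv_fun_smul ds.differentiableAt (h2.differentiableAt (by simp))]
      simp only [add_apply, smul_apply,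
        ContinuousLinearMap.smulRight_apply, e1, e2, h3, h4]
      module)
  have dH := kH.differentiable (by simp)
  have chain : ∀ᶠ q in 𝓝 x, ∀ w, fderiv ℝ (fun q => H (χ q)) q w
      = fderiv ℝ H (χ q) (fderiv ℝ χ q w) := by
    filter_upwards [kχ] with q hq w
    exact DFunLike.congr_fun (fderiv_comp q dH.differentiableAt (hq.differentiableAt (by simp))) w
  -- `P` is `π` times the first coordinate field and `Q` is `κ` times the second one.
  refine ⟨fun q => H (χ q), fun q => π q * r (χ q), fun q => κ q * s (χ q), ?_, ?_, ?_, ?_, ?_, ?_,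
    ?_⟩
  · filter_upwards [kχ] with q hq using kH.contDiffAt.comp q hq
  · filter_upwards [kχ, kπ] with q hq hq' using hq'.mul (kr.contDiffAt.comp q hq)
  · filter_upwards [kχ, kκ] with q hq hq' using hq'.mul (ks.contDiffAt.comp q hq)
  · simpa [χx, r0] using du
  · simpa [χx, s0] using dv
  · filter_upwards [chain, dχ, vP, tχ.eventually hH, hΦ'] with q h1 h2 h3 h4 h5
    have e4 : (fderiv ℝ u q (P q), (0 : ℝ)) = π q • (1, 0) := by ext <;> simp [hπ]
    rw [h1, h2, h3, e4, map_smul, h4.1, h5, smul_smul]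
  · filter_upwards [chain, dχ, uQ, tχ.eventually hH, hΦ'] with q h1 h2 h3 h4 h5
    have e4 : ((0 : ℝ), fderiv ℝ v q (Q q)) = κ q • (0, 1) := by ext <;> simp [hκ]
    rw [h1, h2, h3, e4, map_smul, h4.2, h5, smul_smul]

end Planar

/-! ### Calculus of maps along a surface -/

section Calculus

variable {L : Type*} [TopologicalSpace L] [ChartedSpace (EuclideanSpace ℝ (Fin 2)) L]
  {V : Type*} [NormedAddCommGroup V] [InnerProductSpace ℝ V]
  {f : L → V} {X Y : (p : L) → TangentSpace (𝓡 2) p} {p : L}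

theorem _root_.ContMDiff.mdiff {F : Type*} [NormedAddCommGroup F] [NormedSpace ℝ F] {φ : L → F}
    (h : ContMDiff (𝓡 2) 𝓘(ℝ, F) ∞ φ) (p : L) : MDifferentiableAt (𝓡 2) 𝓘(ℝ, F) φ p :=
  (h p).mdifferentiableAt (by simp)

theorem contMDiff_inner {φ ψ : L → V} (hφ : ContMDiff (𝓡 2) 𝓘(ℝ, V) ∞ φ)
    (hψ : ContMDiff (𝓡 2) 𝓘(ℝ, V) ∞ ψ) :
    ContMDiff (𝓡 2) 𝓘(ℝ, ℝ) ∞ fun p => ⟪φ p, ψ p⟫_ℝ :=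
  contDiff_inner.comp_contMDiff (hφ.prodMk_space hψ)

theorem mvfderiv_inner_apply {φ ψ : L → V} (hφ : MDifferentiableAt (𝓡 2) 𝓘(ℝ, V) φ p)
    (hψ : MDifferentiableAt (𝓡 2) 𝓘(ℝ, V) ψ p) (w : TangentSpace (𝓡 2) p) :
    mvfderiv (𝓡 2) (fun q => ⟪φ q, ψ q⟫_ℝ) p w =
      ⟪mvfderiv (𝓡 2) φ p w, ψ p⟫_ℝ + ⟪φ p, mvfderiv (𝓡 2) ψ p w⟫_ℝ := by
  have h1 : HasFDerivAt (fun z : V × V => ⟪z.1, z.2⟫_ℝ) _ (φ p, ψ p) :=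
    (hasFDerivAt_fst (𝕜 := ℝ)).inner ℝ hasFDerivAt_snd
  have h0 : HasMFDerivAt (𝓡 2) 𝓘(ℝ, V × V) (fun q => (φ q, ψ q)) p
      ((mvfderiv (𝓡 2) φ p).prod (mvfderiv (𝓡 2) ψ p)) :=
    ⟨hφ.continuousAt.prodMk hψ.continuousAt, hφ.hasMFDerivAt.2.prodMk hψ.hasMFDerivAt.2⟩
  have h2 := HasMFDerivAt.comp (f := fun q => (φ q, ψ q)) p h1.hasMFDerivAt h0
  have h3 := DFunLike.congr_fun h2.mfderiv w
  refine h3.trans ?_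
  exact add_comm _ _

theorem inner_mvfderiv_eq_zero {φ : L → V} (hφ : MDifferentiableAt (𝓡 2) 𝓘(ℝ, V) φ p) {c : ℝ}
    (h : ∀ q, ⟪φ q, φ q⟫_ℝ = c) (w : TangentSpace (𝓡 2) p) :
    ⟪mvfderiv (𝓡 2) φ p w, φ p⟫_ℝ = 0 := by
  have h1 := mvfderiv_inner_apply hφ hφ w
  rw [show (fun q => ⟪φ q, φ q⟫_ℝ) = fun _ => c from funext h, mvfderiv_const,
    real_inner_comm (mvfderiv (𝓡 2) φ p w) (φ p)] at h1
  have h2 : (0 : ℝ) = ⟪mvfderiv (𝓡 2) φ p w, φ p⟫_ℝ + ⟪mvfderiv (𝓡 2) φ p w, φ p⟫_ℝ := by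
    simpa [real_inner_comm] using h1
  linarith

theorem inner_mvfderiv_eq_neg {φ ψ : L → V} (hφ : MDifferentiableAt (𝓡 2) 𝓘(ℝ, V) φ p)
    (hψ : MDifferentiableAt (𝓡 2) 𝓘(ℝ, V) ψ p) (h : ∀ q, ⟪φ q, ψ q⟫_ℝ = 0)
    (w : TangentSpace (𝓡 2) p) :
    ⟪mvfderiv (𝓡 2) φ p w, ψ p⟫_ℝ = -⟪φ p, mvfderiv (𝓡 2) ψ p w⟫_ℝ := by
  have h1 := mvfderiv_inner_apply hφ hψ w
  rw [show (fun q => ⟪φ q, ψ q⟫_ℝ) = fun _ => (0 : ℝ) from funext h, mvfderiv_const] at h1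
  have h2 : (0 : ℝ) = ⟪mvfderiv (𝓡 2) φ p w, ψ p⟫_ℝ + ⟪φ p, mvfderiv (𝓡 2) ψ p w⟫_ℝ := h1
  linarith

theorem along_smul_field (c : L → ℝ) (φ : L → V) :
    along (fun q => c q • X q) φ p = c p • along X φ p :=
  map_smul _ _ _

theorem along_smul {c : L → ℝ} {φ : L → V} (hc : MDifferentiableAt (𝓡 2) 𝓘(ℝ, ℝ) c p)
    (hφ : MDifferentiableAt (𝓡 2) 𝓘(ℝ, V) φ p) :
    along X (fun q => c q • φ q) p = c p • along X φ p + along X c p • φ p := by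
  unfold along
  rw [mvfderiv_fun_smul hc hφ]
  rfl

theorem along_add {φ ψ : L → V} (hφ : MDifferentiableAt (𝓡 2) 𝓘(ℝ, V) φ p)
    (hψ : MDifferentiableAt (𝓡 2) 𝓘(ℝ, V) ψ p) :
    along X (fun q => φ q + ψ q) p = along X φ p + along X ψ p := by
  unfold along
  rw [mvfderiv_fun_add hφ hψ]
  rfl

theorem IsSmoothField.smul [IsManifold (𝓡 2) ∞ L] {c : L → ℝ}
    (hc : ContMDiff (𝓡 2) 𝓘(ℝ, ℝ) ∞ c) (hX : IsSmoothField X) :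
    IsSmoothField fun q => c q • X q :=
  ContMDiff.smul_section hc hX

theorem exists_coeff (h : LinearIndependent ℝ ![X p, Y p]) (w : TangentSpace (𝓡 2) p) :
    ∃ a b : ℝ, w = a • X p + b • Y p := by
  obtain ⟨T, hT⟩ := exists_equiv_of_linearIndependent (E := EuclideanSpace ℝ (Fin 2)) (by simp) h
  obtain ⟨c, hc⟩ := T.surjective w
  exact ⟨c.1, c.2, by rw [← hc]; exact hT c⟩

theorem mvfderiv_mem_tangentPlane (w : TangentSpace (𝓡 2) p) :
    mvfderiv (𝓡 2) f p w ∈ tangentPlane f p := ⟨w, rfl⟩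

theorem along_mem_tangentPlane : along X f p ∈ tangentPlane f p := mvfderiv_mem_tangentPlane _

theorem exists_of_mem_tangentPlane (h : LinearIndependent ℝ ![X p, Y p]) {v : V}
    (hv : v ∈ tangentPlane f p) : ∃ a b : ℝ, v = a • along X f p + b • along Y f p := by
  obtain ⟨w, rfl⟩ := hv
  obtain ⟨a, b, rfl⟩ := exists_coeff h w
  exact ⟨a, b, by simp [along]⟩

theorem normalPart_eq_zero_iff {v : V} : normalPart f p v = 0 ↔ v ∈ tangentPlane f p := by
  rw [normalPart, Submodule.starProjection_apply_eq_zero_iff, Submodule.orthogonal_orthogonal]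

theorem normalPart_sub_self_mem (v : V) : v - normalPart f p v ∈ tangentPlane f p := by
  have := Submodule.sub_starProjection_mem_orthogonal (K := (tangentPlane f p)ᗮ) v
  rwa [Submodule.orthogonal_orthogonal] at this

theorem mvfderiv_tangentialPart (v : V) :
    mvfderiv (𝓡 2) f p (tangentialPart f p v) = (tangentPlane f p).starProjection v :=
  (exists_tangentialPart f p v).choose_spec

theorem tangentialPart_eq_zero_iff (hf : Function.Injective (mvfderiv (𝓡 2) f p)) {v : V} :
    tangentialPart f p v = 0 ↔ v ∈ (tangentPlane f p)ᗮ := by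
  rw [← map_eq_zero_iff _ hf, mvfderiv_tangentialPart, Submodule.starProjection_apply_eq_zero_iff]

theorem linearIndependent_of_orthonormal
    (hX : inducedMetric f X X p = 1) (hY : inducedMetric f Y Y p = 1)
    (hXY : inducedMetric f X Y p = 0) : LinearIndependent ℝ ![X p, Y p] := by
  rw [LinearIndependent.pair_iff]
  intro a b hab
  have h1 : a • along X f p + b • along Y f p = 0 := by
    have := congrArg (mvfderiv (𝓡 2) f p) hab
    simpa [along] using this
  have hX' : ⟪along X f p, along X f p⟫_ℝ = 1 := hX
  have hY' : ⟪along Y f p, along Y f p⟫_ℝ = 1 := hY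
  have hXY' : ⟪along X f p, along Y f p⟫_ℝ = 0 := hXY
  have h2 := congrArg (fun v => ⟪v, along X f p⟫_ℝ) h1
  have h3 := congrArg (fun v => ⟪v, along Y f p⟫_ℝ) h1
  simp only [inner_add_left, real_inner_smul_left, inner_zero_left] at h2 h3
  rw [real_inner_comm, hX', real_inner_comm, hXY'] at h2
  rw [hXY', hY'] at h3
  constructor <;> linarith

end Calculus

/-! ### Flatness of the normal bundle -/

section Ricci

variable {L : Type*} [TopologicalSpace L] [ChartedSpace (EuclideanSpace ℝ (Fin 2)) L]
  [IsManifold (𝓡 2) ∞ L]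
  {V : Type*} [NormedAddCommGroup V] [InnerProductSpace ℝ V]
  {f : L → V} {X Y : (p : L) → TangentSpace (𝓡 2) p}

theorem secondForm_symm_eq_zero (hf : IsSurface f) (hX : IsSmoothField X) (hY : IsSmoothField Y)
    {p : L} (h : secondForm f X Y p = 0) : secondForm f Y X p = 0 := by
  rw [secondForm, normalPart_eq_zero_iff] at h ⊢
  have h1 := along_mlieBracket hf.smooth hX hY p
  have h2 : along Y (along X f) p = along X (along Y f) p - along (mlieBracket (𝓡 2) X Y) f p := by
    rw [h1]
    abel
  rw [h2]
  exact sub_mem h along_mem_tangentPlane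

/-- The normal connection in terms of an orthonormal tangent frame. -/
theorem normalConnection_eq (hf : IsSurface f) (hfr : IsOrthonormalFrame f X Y) {ξ : L → V}
    (hξ : IsNormalField f ξ) (B : (p : L) → TangentSpace (𝓡 2) p) (p : L) :
    normalConnection f B ξ p = along B ξ p + (⟪ξ p, along B (along X f) p⟫_ℝ • along X f p +
      ⟪ξ p, along B (along Y f) p⟫_ℝ • along Y f p) := by
  have hX := contMDiff_along hf.smooth hfr.smooth_fst
  have hY := contMDiff_along hf.smooth hfr.smooth_snd
  have li := linearIndependent_of_orthonormal (hfr.unit_fst p) (hfr.unit_snd p) (hfr.orthogonal p)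
  have o1 : ⟪along X f p, along X f p⟫_ℝ = 1 := hfr.unit_fst p
  have o2 : ⟪along Y f p, along Y f p⟫_ℝ = 1 := hfr.unit_snd p
  have o3 : ⟪along X f p, along Y f p⟫_ℝ = 0 := hfr.orthogonal p
  have n1 : ⟪along B ξ p, along X f p⟫_ℝ = -⟪ξ p, along B (along X f) p⟫_ℝ :=
    inner_mvfderiv_eq_neg (hξ.smooth.mdiff p) (hX.mdiff p)
      (fun q => by rw [real_inner_comm]; exact hξ.normal q _ along_mem_tangentPlane) (B p)
  have n2 : ⟪along B ξ p, along Y f p⟫_ℝ = -⟪ξ p, along B (along Y f) p⟫_ℝ :=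
    inner_mvfderiv_eq_neg (hξ.smooth.mdiff p) (hY.mdiff p)
      (fun q => by rw [real_inner_comm]; exact hξ.normal q _ along_mem_tangentPlane) (B p)
  refine Submodule.eq_starProjection_of_mem_orthogonal' (K := (tangentPlane f p)ᗮ)
    (z := -(⟪ξ p, along B (along X f) p⟫_ℝ • along X f p +
      ⟪ξ p, along B (along Y f) p⟫_ℝ • along Y f p)) ?_ ?_ (by abel) |>.trans rfl
  · intro v hv
    obtain ⟨a, b, rfl⟩ := exists_of_mem_tangentPlane li hv
    have o3' : ⟪along Y f p, along X f p⟫_ℝ = 0 := by rw [real_inner_comm, o3]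
    simp only [inner_add_left, inner_add_right, real_inner_smul_left, real_inner_smul_right, o1, o2,
      o3, o3', real_inner_comm (along B ξ p), n1, n2]
    ring
  · rw [Submodule.orthogonal_orthogonal]
    exact neg_mem (add_mem (Submodule.smul_mem _ _ along_mem_tangentPlane)
      (Submodule.smul_mem _ _ along_mem_tangentPlane))

/-- The Ricci equation, for a second fundamental form that is diagonal in an orthonormal frame:
all shape operators are diagonal in that frame, hence commute, and the normal bundle is flat. -/
theorem hasFlatNormalBundle_of_diagonal (hf : IsSurface f) (hfr : IsOrthonormalFrame f X Y)
    (hd : ∀ p, secondForm f X Y p = 0) : HasFlatNormalBundle f := by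
  intro A B ξ hA hB hξ p
  have hX := contMDiff_along hf.smooth hfr.smooth_fst
  have hY := contMDiff_along hf.smooth hfr.smooth_snd
  have li := linearIndependent_of_orthonormal (hfr.unit_fst p) (hfr.unit_snd p) (hfr.orthogonal p)
  have second : ∀ {A B : (p : L) → TangentSpace (𝓡 2) p}, IsSmoothField B →
      normalConnection f A (normalConnection f B ξ) p = normalPart f p (along A (along B ξ) p) +
        (⟪ξ p, along B (along X f) p⟫_ℝ • normalPart f p (along A (along X f) p) +
          ⟪ξ p, along B (along Y f) p⟫_ℝ • normalPart f p (along A (along Y f) p)) := by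
    intro A B hB
    have hBξ := contMDiff_along hξ.smooth hB
    have c1 := contMDiff_inner hξ.smooth (contMDiff_along hX hB)
    have c2 := contMDiff_inner hξ.smooth (contMDiff_along hY hB)
    have t1 : normalPart f p (along X f p) = 0 := normalPart_eq_zero_iff.2 along_mem_tangentPlane
    have t2 : normalPart f p (along Y f p) = 0 := normalPart_eq_zero_iff.2 along_mem_tangentPlane
    rw [normalConnection, funext (normalConnection_eq hf hfr hξ B),
      along_add (ψ := fun q => ⟪ξ q, along B (along X f) q⟫_ℝ • along X f q +
        ⟪ξ q, along B (along Y f) q⟫_ℝ • along Y f q) (hBξ.mdiff p)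
        (((c1.smul hX).add (c2.smul hY)).mdiff p),
      along_add (φ := fun q => ⟪ξ q, along B (along X f) q⟫_ℝ • along X f q)
        (ψ := fun q => ⟪ξ q, along B (along Y f) q⟫_ℝ • along Y f q) ((c1.smul hX).mdiff p)
        ((c2.smul hY).mdiff p),
      along_smul (c1.mdiff p) (hX.mdiff p), along_smul (c2.mdiff p) (hY.mdiff p)]
    simp only [normalPart, map_add, map_smul] at t1 t2 ⊢
    rw [t1, t2]
    simp
  have split : ∀ A : (p : L) → TangentSpace (𝓡 2) p, ∃ a b : ℝ,
      normalPart f p (along A (along X f) p) = a • secondForm f X X p ∧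
      normalPart f p (along A (along Y f) p) = b • secondForm f Y Y p := by
    intro A
    obtain ⟨a, b, hab⟩ := exists_coeff li (A p)
    refine ⟨a, b, ?_, ?_⟩
    · have h1 : along A (along X f) p = a • along X (along X f) p + b • along Y (along X f) p := by
        simp only [along, hab, map_add, map_smul]
      have h2 := secondForm_symm_eq_zero hf hfr.smooth_fst hfr.smooth_snd (hd p)
      simp only [secondForm, normalPart] at h2 ⊢
      rw [h1, map_add, map_smul, map_smul, h2, smul_zero, add_zero]
    · have h1 : along A (along Y f) p = a • along X (along Y f) p + b • along Y (along Y f) p := by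
        simp only [along, hab, map_add, map_smul]
      have h2 := hd p
      simp only [secondForm, normalPart] at h2 ⊢
      rw [h1, map_add, map_smul, map_smul, h2, smul_zero, zero_add]
  have inn : ∀ v : V, ⟪ξ p, v⟫_ℝ = ⟪ξ p, normalPart f p v⟫_ℝ := by
    intro v
    have h1 : ⟪v - normalPart f p v, ξ p⟫_ℝ = 0 := hξ.normal p _ (normalPart_sub_self_mem v)
    rw [inner_sub_left, real_inner_comm, real_inner_comm (ξ p) (normalPart f p v)] at h1
    linarith
  obtain ⟨a1, a2, hA1, hA2⟩ := split A
  obtain ⟨b1, b2, hB1, hB2⟩ := split B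
  rw [normalCurvature, second hB, second hA, normalConnection, along_mlieBracket hξ.smooth hA hB,
    inn (along B (along X f) p), inn (along B (along Y f) p), inn (along A (along X f) p),
    inn (along A (along Y f) p), hA1, hA2, hB1, hB2]
  simp only [normalPart, map_sub, real_inner_smul_right]
  module

end Ricci

/-! ### From principal frames to surfaces of type `D` -/

section Direct

variable {L : Type*} [TopologicalSpace L] [ChartedSpace (EuclideanSpace ℝ (Fin 2)) L]
  [IsManifold (𝓡 2) ∞ L]
  {V : Type*} [NormedAddCommGroup V] [InnerProductSpace ℝ V]
  {X Y : (p : L) → TangentSpace (𝓡 2) p}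

/-- If `X, Y` is an orthonormal principal frame of `h`, then `g = h_* X` satisfies `Y g = -b h_* Y`
and `X (h_* Y) = -a g` with `a = ⟨∇_X X, Y⟩` and `b = ⟨∇_Y Y, X⟩`, so that `X` and `-b⁻¹ Y` are the
fields required of a surface of type `D`. -/
theorem IsGenericPrincipalFrame.isTypeD_along [FiniteDimensional ℝ V] {h : L → V}
    (H : IsGenericPrincipalFrame h X Y) : IsTypeD (along X h) := by
  have hf := H.surface
  have sX := H.frame.smooth_fst
  have sY := H.frame.smooth_snd
  have kX := contMDiff_along hf.smooth sX
  have kY := contMDiff_along hf.smooth sY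
  have o1 : ∀ p, ⟪along X h p, along X h p⟫_ℝ = 1 := H.frame.unit_fst
  have o2 : ∀ p, ⟪along Y h p, along Y h p⟫_ℝ = 1 := H.frame.unit_snd
  have o3 : ∀ p, ⟪along X h p, along Y h p⟫_ℝ = 0 := H.frame.orthogonal
  have o3' : ∀ p, ⟪along Y h p, along X h p⟫_ℝ = 0 := fun p => by rw [real_inner_comm, o3]
  have li : ∀ p, LinearIndependent ℝ ![X p, Y p] := fun p =>
    linearIndependent_of_orthonormal (o1 p) (o2 p) (o3 p)
  have uX : ∀ p w, ⟪mvfderiv (𝓡 2) (along X h) p w, along X h p⟫_ℝ = 0 := fun p w =>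
    inner_mvfderiv_eq_zero (kX.mdiff p) o1 w
  have uY : ∀ p w, ⟪mvfderiv (𝓡 2) (along Y h) p w, along Y h p⟫_ℝ = 0 := fun p w =>
    inner_mvfderiv_eq_zero (kY.mdiff p) o2 w
  have uXY : ∀ p w, ⟪mvfderiv (𝓡 2) (along X h) p w, along Y h p⟫_ℝ
      = -⟪along X h p, mvfderiv (𝓡 2) (along Y h) p w⟫_ℝ := fun p w =>
    inner_mvfderiv_eq_neg (kX.mdiff p) (kY.mdiff p) o3 w
  set a : L → ℝ := fun p => ⟪along X (along X h) p, along Y h p⟫_ℝ with ha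
  set b : L → ℝ := fun p => ⟪along Y (along Y h) p, along X h p⟫_ℝ with hb
  have kb : ContMDiff (𝓡 2) 𝓘(ℝ, ℝ) ∞ b := contMDiff_inner (contMDiff_along kY sY) kX
  have eXY : ∀ p, along X (along Y h) p = -a p • along X h p := by
    intro p
    obtain ⟨c, d, hcd⟩ := exists_of_mem_tangentPlane (li p)
      (normalPart_eq_zero_iff.1 (H.diagonal p))
    have h1 : ⟪along X (along Y h) p, along Y h p⟫_ℝ = 0 := uY p _
    have h2 : a p = -⟪along X h p, along X (along Y h) p⟫_ℝ := uXY p _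
    rw [hcd, inner_add_left, real_inner_smul_left, real_inner_smul_left, o3, o2] at h1
    rw [hcd, inner_add_right, real_inner_smul_right, real_inner_smul_right, o3, o1] at h2
    have hd : d = 0 := by linarith
    rw [hcd, h2, hd]
    simp
  have eYX : ∀ p, along Y (along X h) p = -b p • along Y h p := by
    intro p
    obtain ⟨c, d, hcd⟩ := exists_of_mem_tangentPlane (li p)
      (normalPart_eq_zero_iff.1 (secondForm_symm_eq_zero hf sX sY (H.diagonal p)))
    have h1 : ⟪along Y (along X h) p, along X h p⟫_ℝ = 0 := uX p _
    have h2 : ⟪along Y (along X h) p, along Y h p⟫_ℝ = -b p := by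
      rw [hb]
      simp only
      rw [real_inner_comm (along X h p)]
      exact uXY p _
    rw [hcd, inner_add_left, real_inner_smul_left, real_inner_smul_left, o1, o3'] at h1
    rw [hcd, inner_add_left, real_inner_smul_left, real_inner_smul_left, o3, o2] at h2
    have hc : c = 0 := by linarith
    rw [hcd, ← h2, hc]
    simp
  have na : ∀ p, a p ≠ 0 := by
    intro p h0
    refine H.geodesic_fst p ?_
    have : leviCivita h X X p = 0 := by
      refine (tangentialPart_eq_zero_iff (hf.injective p)).2 fun v hv => ?_
      obtain ⟨c, d, rfl⟩ := exists_of_mem_tangentPlane (li p) hv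
      have h1 : ⟪along X (along X h) p, along X h p⟫_ℝ = 0 := uX p _
      rw [real_inner_comm, inner_add_right, real_inner_smul_right, real_inner_smul_right, h1]
      change c * 0 + d * a p = 0
      rw [h0]
      ring
    rw [this]
    exact zero_mem _
  have nb : ∀ p, b p ≠ 0 := by
    intro p h0
    refine H.geodesic_snd p ?_
    have : leviCivita h Y Y p = 0 := by
      refine (tangentialPart_eq_zero_iff (hf.injective p)).2 fun v hv => ?_
      obtain ⟨c, d, rfl⟩ := exists_of_mem_tangentPlane (li p) hv
      have h1 : ⟪along Y (along Y h) p, along Y h p⟫_ℝ = 0 := uY p _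
      rw [real_inner_comm, inner_add_right, real_inner_smul_right, real_inner_smul_right, h1]
      change c * b p + d * 0 = 0
      rw [h0]
      ring
    rw [this]
    exact zero_mem _
  have hsurf : IsSurface (along X h) := by
    refine ⟨kX, fun p => ?_⟩
    rw [injective_iff_map_eq_zero]
    intro w hw
    obtain ⟨c, d, rfl⟩ := exists_coeff (li p) w
    have h1 : c • along X (along X h) p + d • along Y (along X h) p = 0 := by
      simpa [along] using hw
    rw [eYX] at h1
    -- Modulo the tangent plane of `h`, only the multiple of `α_h(X, X)` is left.
    have hc : c = 0 := by
      by_contra hc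
      refine H.asymptotic_fst p (normalPart_eq_zero_iff.2 ?_)
      have h2 : along X (along X h) p = (c⁻¹ * (d * b p)) • along Y h p := by
        rw [mul_smul, eq_inv_smul_iff₀ hc]
        rw [← sub_eq_zero, ← h1]
        module
      rw [h2]
      exact Submodule.smul_mem _ _ along_mem_tangentPlane
    rw [hc, zero_smul, zero_add, smul_smul] at h1
    have hY : along Y h p ≠ 0 := fun h0 => by
      have := o2 p
      rw [h0, inner_zero_left] at this
      exact zero_ne_one this
    have hd : d = 0 := by
      have := (smul_eq_zero.1 h1).resolve_right hY
      exact (mul_eq_zero.1 this).resolve_right (neg_ne_zero.2 (nb p))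
    rw [hc, hd, zero_smul, zero_smul, add_zero]
  have kc : ContMDiff (𝓡 2) 𝓘(ℝ, ℝ) ∞ fun p => -(b p)⁻¹ := fun p => by
    have : ContDiffAt ℝ ∞ (fun t : ℝ => -t⁻¹) (b p) := (contDiffAt_inv ℝ (nb p)).neg
    exact this.comp_contMDiffAt (kb p)
  have eY' : along (fun p => -(b p)⁻¹ • Y p) (along X h) = along Y h := by
    funext p
    rw [along_smul_field, eYX, smul_smul, neg_mul_neg, inv_mul_cancel₀ (nb p), one_smul]
  have perp : ∀ p, -a p • along X h p ∈ (tangentPlane (along X h) p)ᗮ := by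
    intro p
    refine Submodule.smul_mem _ _ fun v hv => ?_
    obtain ⟨w, rfl⟩ := hv
    exact uX p w
  refine ⟨hsurf, fun p => ?_, X, fun p => -(b p)⁻¹ • Y p, sX, sY.smul kc, fun p => ?_, fun p => ?_,
    fun p => ?_, fun p => ?_, fun p => ?_⟩
  · rw [norm_eq_sqrt_real_inner, o1, Real.sqrt_one]
  · have hlin := li p
    rw [LinearIndependent.pair_iff] at hlin ⊢
    intro c d hcd
    rw [smul_smul] at hcd
    obtain ⟨h1, h2⟩ := hlin c _ hcd
    exact ⟨h1, (mul_eq_zero.1 h2).resolve_right (neg_ne_zero.2 (inv_ne_zero (nb p)))⟩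
  · rw [inducedMetric, eY']
    exact o2 p
  · rw [inducedMetric, eY']
    exact na p
  · rw [leviCivita, eY', eXY]
    exact (tangentialPart_eq_zero_iff (hsurf.injective p)).2 (perp p)
  · rw [sphereSecondForm, eY', eXY, Submodule.starProjection_apply_eq_zero_iff]
    refine Submodule.smul_mem _ _ fun v hv => ?_
    rw [real_inner_comm]
    exact Submodule.mem_orthogonal_singleton_iff_inner_right.1 hv.1

end Direct

/-! ### From surfaces of type `D` to principal frames -/

section Converse

variable {L : Type*} [TopologicalSpace L] [ChartedSpace (EuclideanSpace ℝ (Fin 2)) L]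
  {V : Type*} [NormedAddCommGroup V] [InnerProductSpace ℝ V]
  {X Y : (p : L) → TangentSpace (𝓡 2) p}

/-- For a surface in the unit sphere, `∇_X Y = 0` and `α_g(X, Y) = 0` say that the derivative of
`g_* Y` along `X` is a multiple of the position vector. -/
theorem along_along_eq_smul_self [FiniteDimensional ℝ V] {g : L → V} (hg : IsSurface g)
    (hn : ∀ p, ⟪g p, g p⟫_ℝ = 1) {p : L} (h1 : leviCivita g X Y p = 0)
    (h2 : sphereSecondForm g X Y p = 0) :
    along X (along Y g) p = ⟪along X (along Y g) p, g p⟫_ℝ • g p := by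
  set v := along X (along Y g) p with hv
  have ht : v ∈ (tangentPlane g p)ᗮ := (tangentialPart_eq_zero_iff (hg.injective p)).1 h1
  rw [sphereSecondForm, Submodule.starProjection_apply_eq_zero_iff] at h2
  have hgt : g p ∈ (tangentPlane g p)ᗮ := by
    rintro _ ⟨w, rfl⟩
    exact inner_mvfderiv_eq_zero (hg.smooth.mdiff p) hn w
  set u := v - ⟪v, g p⟫_ℝ • g p with hu
  have hug : ⟪g p, u⟫_ℝ = 0 := by
    rw [hu, inner_sub_right, real_inner_smul_right, hn, mul_one, real_inner_comm, sub_self]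
  have hmem : u ∈ (ℝ ∙ g p)ᗮ ⊓ (tangentPlane g p)ᗮ :=
    ⟨Submodule.mem_orthogonal_singleton_iff_inner_right.2 hug,
      sub_mem ht (Submodule.smul_mem _ _ hgt)⟩
  have huv : ⟪u, v⟫_ℝ = 0 := h2 u hmem
  have huu : ⟪u, u⟫_ℝ = 0 := by
    conv_lhs => rw [hu, inner_sub_right, ← hu]
    rw [huv, real_inner_smul_right, real_inner_comm (g p) u, hug, mul_zero, sub_zero]
  exact sub_eq_zero.1 (inner_self_eq_zero.1 huu)

/-- If `∇_Z Z` is a multiple of `Z`, then `Z (f_* Z)` has no component along a vector tangent to the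
surface and orthogonal to `Z`. -/
theorem inner_along_along_eq_zero {f : L → V} {Z W : (p : L) → TangentSpace (𝓡 2) p} {p : L}
    (hZ : leviCivita f Z Z p ∈ Submodule.span ℝ {Z p}) (hW : ⟪along Z f p, along W f p⟫_ℝ = 0) :
    ⟪along Z (along Z f) p, along W f p⟫_ℝ = 0 := by
  obtain ⟨c, hc⟩ := Submodule.mem_span_singleton.1 hZ
  have h1 := inner_tangentialPart f p (along Z (along Z f) p) (W p)
  change ⟪mvfderiv (𝓡 2) f p (leviCivita f Z Z p), _⟫_ℝ = _ at h1
  rw [← hc, map_smul, real_inner_smul_left] at h1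
  exact h1.symm.trans (mul_eq_zero_of_right c hW)

/-- A surface whose differential is `r g` on `X` and `s g_* Y` on `Y`, where `g` is a surface in the
unit sphere and `X (g_* Y)` is a multiple of `g`, has `X / r, Y / s` as a generic principal frame. -/
theorem isGenericPrincipalFrame_of_along [IsManifold (𝓡 2) ∞ L] {g h : L → V} {lam r s : L → ℝ}
    (hg : IsSurface g)
    (hn : ∀ p, ⟪g p, g p⟫_ℝ = 1) (sX : IsSmoothField X) (sY : IsSmoothField Y)
    (li : ∀ p, LinearIndependent ℝ ![X p, Y p]) (hYY : ∀ p, inducedMetric g Y Y p = 1)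
    (hXY : ∀ p, inducedMetric g X Y p ≠ 0) (hlam : ∀ p, along X (along Y g) p = lam p • g p)
    (kh : ContMDiff (𝓡 2) 𝓘(ℝ, V) ∞ h) (kr : ContMDiff (𝓡 2) 𝓘(ℝ, ℝ) ∞ r)
    (ks : ContMDiff (𝓡 2) 𝓘(ℝ, ℝ) ∞ s) (hr : ∀ p, r p ≠ 0) (hs : ∀ p, s p ≠ 0)
    (hX : ∀ p, along X h p = r p • g p) (hY : ∀ p, along Y h p = s p • along Y g p) :
    IsGenericPrincipalFrame h (fun p => (r p)⁻¹ • X p) (fun p => (s p)⁻¹ • Y p) ∧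
      along (fun p => (r p)⁻¹ • X p) h = g := by
  set X' : (p : L) → TangentSpace (𝓡 2) p := fun p => (r p)⁻¹ • X p
  set Y' : (p : L) → TangentSpace (𝓡 2) p := fun p => (s p)⁻¹ • Y p
  have aX : ∀ (φ : L → V) p, along X' φ p = (r p)⁻¹ • along X φ p := fun φ p =>
    along_smul_field _ φ
  have aY : ∀ (φ : L → V) p, along Y' φ p = (s p)⁻¹ • along Y φ p := fun φ p =>
    along_smul_field _ φ
  have eX : along X' h = g := by
    funext p
    rw [aX, hX, inv_smul_smul₀ (hr p)]
  have eY : along Y' h = along Y g := by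
    funext p
    rw [aY, hY, inv_smul_smul₀ (hs p)]
  have kr' : ContMDiff (𝓡 2) 𝓘(ℝ, ℝ) ∞ fun p => (r p)⁻¹ := fun p =>
    (contDiffAt_inv ℝ (hr p)).comp_contMDiffAt (kr p)
  have ks' : ContMDiff (𝓡 2) 𝓘(ℝ, ℝ) ∞ fun p => (s p)⁻¹ := fun p =>
    (contDiffAt_inv ℝ (hs p)).comp_contMDiffAt (ks p)
  have kg := hg.smooth
  have kY := contMDiff_along kg sY
  have o1 : ∀ p, ⟪along Y g p, along Y g p⟫_ℝ = 1 := hYY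
  have ug : ∀ p w, ⟪mvfderiv (𝓡 2) g p w, g p⟫_ℝ = 0 := fun p w =>
    inner_mvfderiv_eq_zero (kg.mdiff p) hn w
  have o2 : ∀ p, ⟪g p, along Y g p⟫_ℝ = 0 := fun p => by
    rw [real_inner_comm]
    exact ug p (Y p)
  have o2' : ∀ p, ⟪along Y g p, g p⟫_ℝ = 0 := fun p => ug p (Y p)
  have hh : IsSurface h := by
    refine ⟨kh, fun p => ?_⟩
    rw [injective_iff_map_eq_zero]
    intro w hw
    obtain ⟨c, d, rfl⟩ := exists_coeff (li p) w
    have h1 : c • r p • g p + d • s p • along Y g p = 0 := by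
      rw [← hX, ← hY]
      simpa [along] using hw
    have h2 := congrArg (fun v => ⟪g p, v⟫_ℝ) h1
    have h3 := congrArg (fun v => ⟪along Y g p, v⟫_ℝ) h1
    simp only [inner_add_right, real_inner_smul_right, hn, o1, o2, o2', inner_zero_right, mul_zero,
      mul_one, add_zero, zero_add] at h2 h3
    rw [(mul_eq_zero.1 h2).resolve_right (hr p), (mul_eq_zero.1 h3).resolve_right (hs p), zero_smul,
      zero_smul, add_zero]
  have hfr : IsOrthonormalFrame h X' Y' := by
    refine ⟨sX.smul kr', sY.smul ks', fun p => ?_, fun p => ?_, fun p => ?_⟩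
    · rw [inducedMetric, eX]
      exact hn p
    · rw [inducedMetric, eY]
      exact o1 p
    · rw [inducedMetric, eX, eY]
      exact o2 p
  have hd : ∀ p, secondForm h X' Y' p = 0 := by
    intro p
    rw [secondForm, normalPart_eq_zero_iff, eY, aX, hlam]
    have : g p ∈ tangentPlane h p := by
      rw [← eX]
      exact along_mem_tangentPlane
    exact Submodule.smul_mem _ _ (Submodule.smul_mem _ _ this)
  refine ⟨⟨hh, hasFlatNormalBundle_of_diagonal hh hfr hd, hfr, hd, fun p hp => ?_, fun p hp => ?_,
    fun p hp => ?_⟩, eX⟩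
  · have := inner_along_along_eq_zero (W := Y') hp (by rw [eX, eY, o2])
    rw [eX, eY, aX, real_inner_smul_left] at this
    exact hXY p ((mul_eq_zero.1 this).resolve_left (inv_ne_zero (hr p)))
  · have := inner_along_along_eq_zero (W := X') hp (by rw [eX, eY, o2'])
    rw [eX, eY, aY, real_inner_smul_left] at this
    have h1 := (mul_eq_zero.1 this).resolve_left (inv_ne_zero (hs p))
    have h2 : ⟪along Y (along Y g) p, g p⟫_ℝ = -⟪along Y g p, along Y g p⟫_ℝ :=
      inner_mvfderiv_eq_neg (kY.mdiff p) (kg.mdiff p) o2' (Y p)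
    rw [h1, o1] at h2
    norm_num at h2
  · rw [secondForm, normalPart_eq_zero_iff, eX, aX,
      Submodule.smul_mem_iff _ (inv_ne_zero (hr p))] at hp
    obtain ⟨c, d, hcd⟩ := exists_of_mem_tangentPlane (li p) hp
    rw [hX, hY] at hcd
    have h1 : ⟪along X g p, g p⟫_ℝ = 0 := ug p _
    rw [hcd] at h1
    simp only [inner_add_left, real_inner_smul_left, hn, o2', mul_zero, mul_one, add_zero] at h1
    rw [(mul_eq_zero.1 h1).resolve_right (hr p), zero_smul, zero_add, smul_smul] at hcd
    have h3 : X p - (d * s p) • Y p = 0 := by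
      apply hg.injective p
      rw [map_zero, map_sub, map_smul]
      exact sub_eq_zero.2 hcd
    have h4 := LinearIndependent.pair_iff.1 (li p) 1 (-(d * s p)) (by
      rw [one_smul, neg_smul, ← sub_eq_add_neg, h3])
    exact one_ne_zero h4.1

variable [IsManifold (𝓡 2) ∞ L]

theorem contDiffAt_mpullbackWithin_extChartAt_symm (hX : IsSmoothField X) (p : L)
    {q : EuclideanSpace ℝ (Fin 2)} (hq : q ∈ (extChartAt (𝓡 2) p).target) :
    ContDiffAt ℝ ∞ (mpullbackWithin 𝓘(ℝ, EuclideanSpace ℝ (Fin 2)) (𝓡 2)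
      (extChartAt (𝓡 2) p).symm X (range (𝓡 2))) q := by
  have hr : range (𝓡 2) = univ := (𝓡 2).range_eq_univ
  have hnear : (extChartAt (𝓡 2) p).target ∈ 𝓝 q := (isOpen_extChartAt_target p).mem_nhds hq
  have h1 : ContMDiffAt 𝓘(ℝ, EuclideanSpace ℝ (Fin 2)) (𝓡 2) ∞ (extChartAt (𝓡 2) p).symm q :=
    (contMDiffOn_extChartAt_symm p).contMDiffAt hnear
  have h2 := isInvertible_mfderivWithin_extChartAt_symm (I := 𝓡 2) hq
  rw [hr, mfderivWithin_univ] at h2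
  have h3 := ContMDiffAt.mpullback_vectorField_preimage (hX _) h1 h2 (m := ∞) (by simp)
  rw [hr, mpullbackWithin_univ]
  exact contMDiffAt_vectorSpace_iff_contDiffAt.1 h3

theorem contDiffAt_comp_extChartAt_symm_of_mem_target {F : Type*} [NormedAddCommGroup F]
    [NormedSpace ℝ F] {f : L → F} (hf : ContMDiff (𝓡 2) 𝓘(ℝ, F) ∞ f)
    (p : L) {q : EuclideanSpace ℝ (Fin 2)} (hq : q ∈ (extChartAt (𝓡 2) p).target) :
    ContDiffAt ℝ ∞ (fun q => f ((extChartAt (𝓡 2) p).symm q)) q :=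
  contMDiffAt_iff_contDiffAt.1 ((hf _).comp q
    ((contMDiffOn_extChartAt_symm p).contMDiffAt ((isOpen_extChartAt_target p).mem_nhds hq)))

/-- The equations `X h = r g`, `Y h = s g_* Y` are solvable near every point: transport of
`exists_integral_of_frame` to a chart. -/
theorem exists_local_integral [CompleteSpace V] {g : L → V} {lam : L → ℝ}
    (kg : ContMDiff (𝓡 2) 𝓘(ℝ, V) ∞ g) (klam : ContMDiff (𝓡 2) 𝓘(ℝ, ℝ) ∞ lam)
    (sX : IsSmoothField X) (sY : IsSmoothField Y)
    (hlam : ∀ p, along X (along Y g) p = lam p • g p) {p : L}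
    (li : LinearIndependent ℝ ![X p, Y p]) :
    ∃ (U : TopologicalSpace.Opens L) (h : L → V) (r s : L → ℝ), p ∈ U ∧ ∀ q ∈ U,
      ContMDiffAt (𝓡 2) 𝓘(ℝ, V) ∞ h q ∧ ContMDiffAt (𝓡 2) 𝓘(ℝ, ℝ) ∞ r q ∧
      ContMDiffAt (𝓡 2) 𝓘(ℝ, ℝ) ∞ s q ∧ r q ≠ 0 ∧ s q ≠ 0 ∧ along X h q = r q • g q ∧
      along Y h q = s q • along Y g q := by
  set e := extChartAt (𝓡 2) p with he
  have hp : e.symm (e p) = p := extChartAt_to_inv p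
  have kY := contMDiff_along kg sY
  have hnear : ∀ᶠ q in 𝓝 (e p), q ∈ e.target := extChartAt_target_mem_nhds p
  let P (Z : (p : L) → TangentSpace (𝓡 2) p) :
      EuclideanSpace ℝ (Fin 2) → EuclideanSpace ℝ (Fin 2) :=
    mpullbackWithin 𝓘(ℝ, EuclideanSpace ℝ (Fin 2)) (𝓡 2) e.symm Z (range (𝓡 2))
  have hli : LinearIndependent ℝ ![P X (e p), P Y (e p)] := by
    have inv := isInvertible_mfderivWithin_extChartAt_symm (I := 𝓡 2) (mem_extChartAt_target p)
    have hP : ∀ Z, mfderivWithin 𝓘(ℝ, EuclideanSpace ℝ (Fin 2)) (𝓡 2) e.symm (range (𝓡 2)) (e p)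
        (P Z (e p)) = Z (e.symm (e p)) := fun Z => inv.self_apply_inverse _
    rw [← hp] at li
    rw [LinearIndependent.pair_iff] at li ⊢
    intro c d hcd
    refine li c d ?_
    have := congrArg
      (mfderivWithin 𝓘(ℝ, EuclideanSpace ℝ (Fin 2)) (𝓡 2) e.symm (range (𝓡 2)) (e p)) hcd
    rw [← hP X, ← hP Y, ← map_smul, ← map_smul, ← map_add]
    exact this.trans (map_zero _)
  obtain ⟨H, r, s, kH, kr, ks, r0, s0, hX, hY⟩ := exists_integral_of_frame (by simp)
    (P := P X) (Q := P Y) (G := fun q => g (e.symm q)) (N := fun q => along Y g (e.symm q))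
    (lam := fun q => lam (e.symm q)) (x := e p)
    (hnear.mono fun q hq => contDiffAt_mpullbackWithin_extChartAt_symm sX p hq)
    (hnear.mono fun q hq => contDiffAt_mpullbackWithin_extChartAt_symm sY p hq)
    (hnear.mono fun q hq => contDiffAt_comp_extChartAt_symm_of_mem_target kg p hq)
    (hnear.mono fun q hq => contDiffAt_comp_extChartAt_symm_of_mem_target kY p hq)
    (hnear.mono fun q hq => contDiffAt_comp_extChartAt_symm_of_mem_target klam p hq) hli
    (hnear.mono fun q hq =>
      (along_extChartAt_symm p hq (kY.mdiff _) X).symm.trans (hlam _))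
    (hnear.mono fun q hq => (along_extChartAt_symm p hq (kg.mdiff _) Y).symm)
  have hall := kH.and <| kr.and <| ks.and <| (kr.self_of_nhds.continuousAt.eventually_ne r0).and <|
    (ks.self_of_nhds.continuousAt.eventually_ne s0).and <| hX.and hY
  obtain ⟨W, hW, oW, pW⟩ := eventually_nhds_iff.1 hall
  refine ⟨⟨e.source ∩ e ⁻¹' W, (continuousOn_extChartAt p).isOpen_inter_preimage
    (isOpen_extChartAt_source p) oW⟩, fun q => H (e q), fun q => r (e q), fun q => s (e q),
    ⟨mem_extChartAt_source p, pW⟩, ?_⟩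
  rintro q ⟨hq, hqW⟩
  obtain ⟨h1, h2, h3, h4, h5, h6, h7⟩ := hW _ hqW
  have eq : e.symm (e q) = q := e.left_inv hq
  have ke : ContMDiffAt (𝓡 2) 𝓘(ℝ, EuclideanSpace ℝ (Fin 2)) ∞ e q :=
    contMDiffAt_extChartAt' (by rwa [he, extChartAt_source] at hq)
  have kHe : ContMDiffAt (𝓡 2) 𝓘(ℝ, V) ∞ (fun q => H (e q)) q := h1.comp_contMDiffAt ke
  have hal : ∀ Z, along Z (fun q => H (e q)) q = fderiv ℝ H (e q) (P Z (e q)) := by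
    intro Z
    have hqt : e q ∈ e.target := e.map_source hq
    have h8 := along_extChartAt_symm (f := fun q => H (e q)) p hqt
      (by rw [← he, eq]; exact kHe.mdifferentiableAt (by simp)) Z
    rw [← he, eq] at h8
    have h9 : (fun q => H (e q)) ∘ e.symm =ᶠ[𝓝 (e q)] H := by
      filter_upwards [(isOpen_extChartAt_target p).mem_nhds hqt] with y hy
      exact congrArg H (e.right_inv hy)
    rw [h8, h9.fderiv_eq]
  refine ⟨kHe, h2.comp_contMDiffAt ke, h3.comp_contMDiffAt ke, h4, h5, ?_, ?_⟩
  · rw [hal, h6]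
    exact congrArg (fun z => r (e q) • g z) eq
  · rw [hal, h7]
    exact congrArg (fun z => s (e q) • along Y g z) eq

end Converse

/-! ### Restriction to open subsets -/

section Restriction

variable {L : Type*} [TopologicalSpace L] [ChartedSpace (EuclideanSpace ℝ (Fin 2)) L]
  {V : Type*} [NormedAddCommGroup V] [InnerProductSpace ℝ V] (U : TopologicalSpace.Opens L)
  {X Y : (p : L) → TangentSpace (𝓡 2) p}

/-- The restriction of a vector field to an open subset, as the pullback by the inclusion. -/
noncomputable def restrictField (X : (p : L) → TangentSpace (𝓡 2) p) :
    (q : U) → TangentSpace (𝓡 2) q :=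
  mpullback (𝓡 2) (𝓡 2) (Subtype.val : U → L) X

/-- The inclusion of an open subset is the identity in the charts used to define its derivative. -/
theorem isInvertible_mfderiv_subtype_val (q : U) :
    (mfderiv (𝓡 2) (𝓡 2) (Subtype.val : U → L) q).IsInvertible := by
  have hd : MDifferentiableAt (𝓡 2) (𝓡 2) (Subtype.val : U → L) q :=
    (contMDiff_subtype_val (n := 1)).contMDiffAt.mdifferentiableAt one_ne_zero
  have h1 : writtenInExtChartAt (𝓡 2) (𝓡 2) q (Subtype.val : U → L)
      =ᶠ[𝓝 (extChartAt (𝓡 2) q q)] id := by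
    have h2 := TopologicalSpace.Opens.chartAt_subtype_val_symm_eventuallyEq
      (H := EuclideanSpace ℝ (Fin 2)) U (x := q)
    have h3 : ∀ᶠ y in 𝓝 (chartAt (EuclideanSpace ℝ (Fin 2)) q.val q.val),
        y ∈ (chartAt (EuclideanSpace ℝ (Fin 2)) q.val).target :=
      (chartAt (EuclideanSpace ℝ (Fin 2)) q.val).open_target.mem_nhds
        (mem_chart_target _ _)
    filter_upwards [h2, h3] with y hy hy'
    change chartAt (EuclideanSpace ℝ (Fin 2)) q.val
      ((chartAt (EuclideanSpace ℝ (Fin 2)) q).symm y).val = y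
    have : ((chartAt (EuclideanSpace ℝ (Fin 2)) q).symm y).val = _ := hy.symm
    rw [this]
    exact (chartAt (EuclideanSpace ℝ (Fin 2)) q.val).right_inv hy'
  have h4 : mfderiv (𝓡 2) (𝓡 2) (Subtype.val : U → L) q
      = ContinuousLinearMap.id ℝ (EuclideanSpace ℝ (Fin 2)) := by
    rw [hd.mfderiv, (𝓡 2).range_eq_univ, fderivWithin_univ, h1.fderiv_eq, fderiv_id]
  rw [h4]
  exact ⟨ContinuousLinearEquiv.refl ℝ _, rfl⟩

theorem mfderiv_subtype_val_restrictField (q : U) :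
    mfderiv (𝓡 2) (𝓡 2) (Subtype.val : U → L) q (restrictField U X q) = X q :=
  (isInvertible_mfderiv_subtype_val U q).self_apply_inverse _

theorem along_restrictField {φ : L → V} {q : U}
    (hφ : MDifferentiableAt (𝓡 2) 𝓘(ℝ, V) φ q) :
    along (restrictField U X) (fun q : U => φ q) q = along X φ q := by
  have hd : MDifferentiableAt (𝓡 2) (𝓡 2) (Subtype.val : U → L) q :=
    (contMDiff_subtype_val (n := 1)).contMDiffAt.mdifferentiableAt one_ne_zero
  have h1 := mfderiv_comp_apply q hφ hd (restrictField U X q)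
  rw [mfderiv_subtype_val_restrictField] at h1
  exact h1

theorem IsSmoothField.restrictField [IsManifold (𝓡 2) ∞ L] (hX : IsSmoothField X) :
    IsSmoothField (restrictField U X) :=
  ContMDiff.mpullback_vectorField (n := ∞) hX contMDiff_subtype_val
    (isInvertible_mfderiv_subtype_val U) (by simp)

theorem linearIndependent_restrictField {q : U}
    (h : LinearIndependent ℝ ![X q, Y q]) :
    LinearIndependent ℝ ![restrictField U X q, restrictField U Y q] := by
  rw [LinearIndependent.pair_iff] at h ⊢
  intro c d hcd
  refine h c d ?_
  rw [← mfderiv_subtype_val_restrictField U q (X := X),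
    ← mfderiv_subtype_val_restrictField U q (X := Y), ← map_smul, ← map_smul, ← map_add]
  exact (congrArg _ hcd).trans (map_zero _)

theorem IsSurface.restrict {g : L → V} (hg : IsSurface g) : IsSurface fun q : U => g q := by
  refine ⟨hg.smooth.comp contMDiff_subtype_val, fun q => ?_⟩
  have hd : MDifferentiableAt (𝓡 2) (𝓡 2) (Subtype.val : U → L) q :=
    (contMDiff_subtype_val (n := 1)).contMDiffAt.mdifferentiableAt one_ne_zero
  have h1 : mvfderiv (𝓡 2) (fun q : U => g q) q = (mvfderiv (𝓡 2) g q).comp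
      (mfderiv (𝓡 2) (𝓡 2) (Subtype.val : U → L) q) := mfderiv_comp q (hg.smooth.mdiff q) hd
  rw [h1, ContinuousLinearMap.coe_comp]
  refine (hg.injective q).comp ?_
  obtain ⟨e, he⟩ := isInvertible_mfderiv_subtype_val U q
  rw [← he]
  exact e.injective

/-- Every surface of type `D` is locally the image of the first field of a generic principal
frame. -/
theorem exists_isGenericPrincipalFrame [IsManifold (𝓡 2) ∞ L] [FiniteDimensional ℝ V] {g : L → V}
    (hg : IsTypeD g) (p : L) :
    ∃ U : TopologicalSpace.Opens L, p ∈ U ∧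
      ∃ (h : U → V) (X Y : (q : U) → TangentSpace (𝓡 2) q),
        IsGenericPrincipalFrame h X Y ∧ ∀ q : U, g q = along X h q := by
  obtain ⟨hs, hn, X, Y, sX, sY, li, hYY, hXY, hLC, hα⟩ := hg
  have : CompleteSpace V := FiniteDimensional.complete ℝ V
  have kg := hs.smooth
  have kY := contMDiff_along kg sY
  have hn' : ∀ p, ⟪g p, g p⟫_ℝ = 1 := fun p => by rw [real_inner_self_eq_norm_sq, hn, one_pow]
  have hlam : ∀ p, along X (along Y g) p = ⟪along X (along Y g) p, g p⟫_ℝ • g p := fun p =>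
    along_along_eq_smul_self hs hn' (hLC p) (hα p)
  obtain ⟨U, h, r, s, hpU, hU⟩ := exists_local_integral kg
    (contMDiff_inner (contMDiff_along kY sX) kg) sX sY hlam (li p)
  have eg : ∀ (Z : (p : L) → TangentSpace (𝓡 2) p),
      along (restrictField U Z) (fun q : U => g q) = fun q : U => along Z g q := fun Z =>
    funext fun q => along_restrictField U (kg.mdiff q)
  have smooth : ∀ {F : Type _} [NormedAddCommGroup F] [NormedSpace ℝ F] {φ : L → F},
      (∀ q ∈ U, ContMDiffAt (𝓡 2) 𝓘(ℝ, F) ∞ φ q) →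
      ContMDiff (𝓡 2) 𝓘(ℝ, F) ∞ fun q : U => φ q := fun hφ q =>
    (hφ q q.2).comp q contMDiff_subtype_val.contMDiffAt
  have smoothR : ∀ {φ : L → ℝ}, (∀ q ∈ U, ContMDiffAt (𝓡 2) 𝓘(ℝ, ℝ) ∞ φ q) →
      ContMDiff (𝓡 2) 𝓘(ℝ, ℝ) ∞ fun q : U => φ q := fun hφ q =>
    (hφ q q.2).comp q contMDiff_subtype_val.contMDiffAt
  have main := isGenericPrincipalFrame_of_along (g := fun q : U => g q) (h := fun q : U => h q)
    (X := restrictField U X) (Y := restrictField U Y) (r := fun q : U => r q)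
    (s := fun q : U => s q) (lam := fun q : U => ⟪along X (along Y g) q, g q⟫_ℝ)
    (hs.restrict U) (fun q => hn' q) (sX.restrictField U) (sY.restrictField U)
    (fun q => linearIndependent_restrictField U (li q))
    (fun q => by
      rw [inducedMetric, eg]
      exact hYY q)
    (fun q => by
      rw [inducedMetric, eg, eg]
      exact hXY q)
    (fun q => by
      rw [eg, along_restrictField U (kY.mdiff q)]
      exact hlam q)
    (smooth fun q hq => (hU q hq).1) (smoothR fun q hq => (hU q hq).2.1)
    (smoothR fun q hq => (hU q hq).2.2.1) (fun q => (hU q q.2).2.2.2.1)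
    (fun q => (hU q q.2).2.2.2.2.1)
    (fun q => by
      rw [along_restrictField U ((hU q q.2).1.mdifferentiableAt (by simp))]
      exact (hU q q.2).2.2.2.2.2.1)
    (fun q => by
      rw [along_restrictField U ((hU q q.2).1.mdifferentiableAt (by simp)), eg]
      exact (hU q q.2).2.2.2.2.2.2)
  exact ⟨U, hpU, _, _, _, main.1, fun q => (congrFun main.2 q).symm⟩

end Restriction

end SurfaceGeometry

theorem mainTheorem4 (n : ℕ) (hn : 3 ≤ n)
    {L : Type*} [TopologicalSpace L] [T2Space L] [SecondCountableTopology L]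
    [ChartedSpace (EuclideanSpace ℝ (Fin 2)) L] [IsManifold (𝓡 2) ∞ L] :
    (∀ (h : L → EuclideanSpace ℝ (Fin (n + 1))) (X Y : (p : L) → TangentSpace (𝓡 2) p),
      SurfaceGeometry.IsGenericPrincipalFrame h X Y →
        SurfaceGeometry.IsTypeD (SurfaceGeometry.along X h)) ∧
    (∀ g : L → EuclideanSpace ℝ (Fin (n + 1)), SurfaceGeometry.IsTypeD g →
      ∀ p : L, ∃ U : TopologicalSpace.Opens L, p ∈ U ∧
        ∃ (h : U → EuclideanSpace ℝ (Fin (n + 1))) (X Y : (q : U) → TangentSpace (𝓡 2) q),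
          SurfaceGeometry.IsGenericPrincipalFrame h X Y ∧
            ∀ q : U, g q = SurfaceGeometry.along X h q) :=
  ⟨fun _ _ _ H => H.isTypeD_along,
    fun _ hg p => SurfaceGeometry.exists_isGenericPrincipalFrame hg p⟩
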